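/- **Setting.** Let $f(z,w)=(p(z),q(z,w))$ be a holomorphic skew product germ at the origin of $\mathbb C^2$ with a superattracting fixed point there: $p(z)=\sum_{i\ge\delta}a_iz^i$ with $\delta\ge 2$, $a_\delta\ne0$, and $q(z,w)=\sum_{i,j\ge0}b_{ij}z^iw^j$ with $b_{00}=b_{01}=0$, both series converging near the origin. Let the Newton polygon $N(q)$ be the convex hull of the union of the quadrants $\{x\ge i,\ y\ge j\}$ over all $(i,j)$ with $b_{ij}\neq0$, with vertices $(n_1,m_1),\dots,(n_s,m_s)$, $n_1<\dots<n_s$, $m_1>\dots>m_s$. For $1\le k\le s-1$ let $T_k$ be the $y$-intercept of the line through $(n_k,m_k)$ and $(n_{k+1},m_{k+1})$. Define $(\gamma,d)$ and $0\le l_1<\infty$, $0<l_2\le\infty$ as follows. 1. If $s=1$: $(\gamma,d)=(n_1,m_1)$, $l_1=l_2^{-1}=0$. 2. If $s>1$ and $\delta\le T_{s-1}$: $(\gamma,d)=(n_s,m_s)$, $l_1=\frac{n_s-n_{s-1}}{m_{s-1}-m_s}$, $l_2^{-1}=0$. 3. If $s>1$ and $T_1\le\delta$: $(\gamma,d)=(n_1,m_1)$,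 $l_1=0$, $l_2=\frac{n_2-n_1}{m_1-m_2}$. 4. If $T_k\le\delta\le T_{k-1}$ for some $2\le k\le s-1$: $(\gamma,d)=(n_k,m_k)$, $l_1=\frac{n_k-n_{k-1}}{m_{k-1}-m_k}$, $l_1+l_2=\frac{n_{k+1}-n_k}{m_k-m_{k+1}}$. Let $U_r=\{(z,w): |z|^{l_1l_2^{-1}+1}<r|w|^{l_2^{-1}},\ |w|<r|z|^{l_1}\}$ (with $0^0=1$), $f_0(z,w)=(a_\delta z^\delta,\,b_{\gamma d}z^\gamma w^d)$ and $\|(z,w)\|=\max\{|z|,|w|\}$. **Theorem.** Suppose $d=1$ and $\delta\ne T_k$ for every $1\le k\le s-1$. Then there are $r_0>0$ and a map $\phi$, with $\phi(0)=0$, such that: * for all $0<r\le r_0$ and $N\ge0$, every $x=(z,w)\in U_r$ satisfies $f^N(x)\in U_{r/2^N}$, or $z=0$ and $f^N(x)=0$; in particular $f(x)\in U_r$ for $x\in U_r$, except that $f(x)$ may be the origin when $z=0$; * for all $0<r\le r_0$, $\phi$ is a biholomorphic map from $U_r$ onto the open set $\phi(U_r)$, and $\phi\circ f=f_0\circ\phi$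 on $U_r$; * for every $\varepsilon>0$ there is $0<r_1\le r_0$ such that $\|\phi(x)-x\|<\varepsilon\|x\|$ for all $x\in U_{r_1}$, $x\ne0$. The condition $\delta\ne T_k$ cannot be dropped: for every integer $\gamma\ge1$ the map $f(z,w)=(z^2,\,z^\gamma w+z^{2\gamma})$ has $s>1$, $\delta=2=T_1$ and admits a choice of the data above (case 3) with dominant exponent $(\gamma,1)$, so $d=1$, and some weights $l_1,l_2$, for which there is no $r>0$ and no map $\phi$ with $\phi(0)=0$ such that $f$ maps $U_r$ into itself (apart from points with $z=0$, which may be sent to the origin), $\phi$ is biholomorphic on $U_r$ onto an open image, and $\phi\circ f=f_0\circ\phi$ on $U_r$. -/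

import Mathlib

namespace BottcherSkew

/-- `p z = ∑ aᵢ zⁱ`, the power series converging (absolutely) to `p` on a disc around `0`. -/
def HasSeriesAtZero (p : ℂ → ℂ) (a : ℕ → ℂ) : Prop :=
  ∃ ρ > 0, ∀ z : ℂ, ‖z‖ < ρ → HasSum (fun i : ℕ => a i * z ^ i) (p z)

/-- `q (z, w) = ∑ bᵢⱼ zⁱ wʲ`, the double power series converging (absolutely) to `q` on a bidisc
around the origin. -/
def HasDoubleSeriesAtZero (q : ℂ × ℂ → ℂ) (b : ℕ → ℕ → ℂ) : Prop :=
  ∃ ρ > 0, ∀ z w : ℂ, ‖z‖ < ρ → ‖w‖ < ρ →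
    HasSum (fun ij : ℕ × ℕ => b ij.1 ij.2 * z ^ ij.1 * w ^ ij.2) (q (z, w))

/-- The skew product `f (z, w) = (p z, q (z, w))`. -/
def skewProduct (p : ℂ → ℂ) (q : ℂ × ℂ → ℂ) : ℂ × ℂ → ℂ × ℂ :=
  fun x => (p x.1, q x)

/-- `(p, q)` is a holomorphic skew product germ at the origin with power series `a`, `b`, for which
the origin is a superattracting fixed point and `p z = a_δ z ^ δ + O(z ^ (δ + 1))`, `a_δ ≠ 0`.
The origin is fixed iff `a₀ = b₀₀ = 0`; the eigenvalues of the (triangular) differential at the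
origin are `a₁` and `b₀₁`. -/
structure IsSuperattractingSkewProduct (p : ℂ → ℂ) (q : ℂ × ℂ → ℂ)
    (a : ℕ → ℂ) (b : ℕ → ℕ → ℂ) (δ : ℕ) : Prop where
  series_fst : HasSeriesAtZero p a
  series_snd : HasDoubleSeriesAtZero q b
  two_le : 2 ≤ δ
  coeff_ne_zero : a δ ≠ 0
  coeff_eq_zero : ∀ i < δ, a i = 0
  fixed : b 0 0 = 0
  eigenvalue : b 0 1 = 0

/-- The Newton polygon of `∑ bᵢⱼ zⁱ wʲ`: the convex hull of the union of the quadrants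
`D(i, j) = {(x, y) | x ≥ i, y ≥ j}` over all `(i, j)` with `bᵢⱼ ≠ 0`. -/
def newtonPolygon (b : ℕ → ℕ → ℂ) : Set (ℝ × ℝ) :=
  convexHull ℝ {v | ∃ i j : ℕ, b i j ≠ 0 ∧ (i : ℝ) ≤ v.1 ∧ (j : ℝ) ≤ v.2}

/-- `(n 1, m 1), …, (n s, m s)` are the vertices of the Newton polygon, listed so that
`n 1 < ⋯ < n s` and `m 1 > ⋯ > m s`. -/
structure IsVertexList (b : ℕ → ℕ → ℂ) (s : ℕ) (n m : ℕ → ℕ) : Prop where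
  strictMono : StrictMonoOn n (Set.Icc 1 s)
  strictAnti : StrictAntiOn m (Set.Icc 1 s)
  vertices : (newtonPolygon b).extremePoints ℝ =
    (fun k : ℕ => ((n k : ℝ), (m k : ℝ))) '' Set.Icc 1 s

/-- Such a list always exists. -/
theorem exists_isVertexList (b : ℕ → ℕ → ℂ) : ∃ (s : ℕ) (n m : ℕ → ℕ), IsVertexList b s n m := by
  classical
  set V : Set (ℕ × ℕ) := {v | ((v.1 : ℝ), (v.2 : ℝ)) ∈ (newtonPolygon b).extremePoints ℝ} with hV
  have hcorner : ∀ v ∈ (newtonPolygon b).extremePoints ℝ, ∀ i j : ℕ, b i j ≠ 0 →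
      (i : ℝ) ≤ v.1 → (j : ℝ) ≤ v.2 → v = ((i : ℝ), (j : ℝ)) := by
    intro v hv i j hb hi hj
    have h1 : ((i : ℝ), (j : ℝ)) ∈ newtonPolygon b :=
      subset_convexHull ℝ _ ⟨i, j, hb, le_refl _, le_refl _⟩
    have h2 : ((2 * v.1 - i, 2 * v.2 - j) : ℝ × ℝ) ∈ newtonPolygon b :=
      subset_convexHull ℝ _ ⟨i, j, hb, by simp; linarith, by simp; linarith⟩
    refine (hv.2 h1 h2 ⟨1/2, 1/2, by norm_num, by norm_num, by norm_num, ?_⟩).symm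
    ext <;> simp <;> ring
  have hex : ∀ v ∈ (newtonPolygon b).extremePoints ℝ, ∃ i j : ℕ, b i j ≠ 0 ∧
      v = ((i : ℝ), (j : ℝ)) := by
    intro v hv
    obtain ⟨i, j, hb, hi, hj⟩ := extremePoints_convexHull_subset hv
    exact ⟨i, j, hb, hcorner v hv i j hb hi hj⟩
  have hanti : ∀ u ∈ V, ∀ v ∈ V, u.1 ≤ v.1 → u.2 ≤ v.2 → u = v := by
    intro u hu v hv h1 h2
    obtain ⟨i, j, hb, h⟩ := hex _ hu
    simp only [Prod.mk.injEq, Nat.cast_inj] at h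
    have := hcorner _ hv u.1 u.2 (by rw [h.1, h.2]; exact hb) (Nat.cast_le.2 h1)
      (Nat.cast_le.2 h2)
    simp only [Prod.mk.injEq, Nat.cast_inj] at this
    exact Prod.ext this.1.symm this.2.symm
  have hfin : V.Finite := by
    refine IsAntichain.finite_of_partiallyWellOrderedOn (r := (· ≤ ·)) ?_ (Set.isPWO_of_wellQuasiOrderedLE V)
    intro u hu v hv huv hle
    exact huv (hanti u hu v hv hle.1 hle.2)
  set F := hfin.toFinset.image Prod.fst with hF
  have hFm : ∀ i, i ∈ F ↔ ∃ j, (i, j) ∈ V := by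
    intro i; simp [hF]
  choose! g hg using fun i (hi : i ∈ F) => (hFm i).1 hi
  set e := F.orderEmbOfFin rfl
  set n : ℕ → ℕ := fun k => if h : k - 1 < F.card then e ⟨k - 1, h⟩ else 0 with hn
  have hnF : ∀ k ∈ Set.Icc 1 F.card, n k ∈ F := by
    intro k hk
    have h : k - 1 < F.card := by have := hk.1; have := hk.2; omega
    simp only [hn, dif_pos h]
    exact F.orderEmbOfFin_mem rfl _
  have hmono : StrictMonoOn n (Set.Icc 1 F.card) := by
    intro k hk l hl hkl
    have h : k - 1 < F.card := by have := hk.1; have := hk.2; omega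
    have h' : l - 1 < F.card := by have := hl.1; have := hl.2; omega
    simp only [hn, dif_pos h, dif_pos h']
    apply e.strictMono
    have := hk.1
    simp only [Fin.mk_lt_mk]; omega
  refine ⟨F.card, n, fun k => g (n k), hmono, ?_, ?_⟩
  · intro k hk l hl hkl
    by_contra hcon
    have h1 := hmono hk hl hkl
    have := hanti _ (hg _ (hnF k hk)) _ (hg _ (hnF l hl)) h1.le (not_lt.1 hcon)
    simp only [Prod.mk.injEq] at this
    omega
  · ext v
    constructor
    · intro hv
      obtain ⟨i, j, hb, rfl⟩ := hex v hv
      have hi : i ∈ F := (hFm i).2 ⟨j, hv⟩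
      have hj : g i = j := by
        rcases le_total (g i) j with h | h
        · exact congrArg Prod.snd (hanti _ (hg i hi) (i, j) hv le_rfl h)
        · exact (congrArg Prod.snd (hanti (i, j) hv _ (hg i hi) le_rfl h)).symm
      have : i ∈ Set.range e := by rw [Finset.range_orderEmbOfFin]; exact hi
      obtain ⟨k, hk⟩ := this
      have hnk : n (k + 1) = i := by
        simp only [hn, Nat.add_sub_cancel, k.2, dif_pos]; exact hk
      refine ⟨k + 1, ⟨by omega, k.2⟩, ?_⟩
      simp [hnk, hj]
    · rintro ⟨k, hk, rfl⟩
      exact hg _ (hnF k hk)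

/-- `T_k`: the `y`-intercept of the line through `(n k, m k)` and `(n (k+1), m (k+1))`. -/
noncomputable def intercept (n m : ℕ → ℕ) (k : ℕ) : ℝ :=
  (m k : ℝ) + n k * (((m k : ℝ) - m (k + 1)) / ((n (k + 1) : ℝ) - n k))

/-- `(n j - n i) / (m i - m j)`. -/
noncomputable def weight (n m : ℕ → ℕ) (i j : ℕ) : ℝ :=
  ((n j : ℝ) - n i) / ((m i : ℝ) - m j)

/-- `(γ, d)` is the exponent of the dominant term and `l₁`, `κ = l₂⁻¹` (with `κ = 0` for `l₂ = ∞`)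
are the weights attached to the degree `δ` and the vertices of the Newton polygon; the four
alternatives are the four cases of the definition. -/
def IsDominantData (δ s : ℕ) (n m : ℕ → ℕ) (γ d : ℕ) (l₁ κ : ℝ) : Prop :=
  (s = 1 ∧ γ = n 1 ∧ d = m 1 ∧ l₁ = 0 ∧ κ = 0) ∨
  (1 < s ∧ (δ : ℝ) ≤ intercept n m (s - 1) ∧
    γ = n s ∧ d = m s ∧ l₁ = weight n m (s - 1) s ∧ κ = 0) ∨
  (1 < s ∧ intercept n m 1 ≤ (δ : ℝ) ∧
    γ = n 1 ∧ d = m 1 ∧ l₁ = 0 ∧ κ = (weight n m 1 2)⁻¹) ∨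
  (∃ k, 2 ≤ k ∧ k + 1 ≤ s ∧
    intercept n m k ≤ (δ : ℝ) ∧ (δ : ℝ) ≤ intercept n m (k - 1) ∧
    γ = n k ∧ d = m k ∧ l₁ = weight n m (k - 1) k ∧
    ∃ l₂ : ℝ, l₁ + l₂ = weight n m k (k + 1) ∧ κ = l₂⁻¹)

/-- The open set
`U_r = {|z| ^ (l₁ l₂⁻¹ + 1) < r |w| ^ (l₂⁻¹), |w| < r |z| ^ l₁}`, with `κ = l₂⁻¹`.
It equals `{|z| ^ (l₁ + l₂) < r ^ l₂ |w|, |w| < r |z| ^ l₁}` for `l₂ < ∞`, and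
`{|z| < r, |w| < r |z| ^ l₁}` for `l₂ = ∞`. -/
def wedge (l₁ κ r : ℝ) : Set (ℂ × ℂ) :=
  {x | ‖x.1‖ ^ (l₁ * κ + 1) < r * ‖x.2‖ ^ κ ∧ ‖x.2‖ < r * ‖x.1‖ ^ l₁}

/-- The monomial map `(z, w) ↦ (α z ^ δ, β z ^ γ w ^ d)`. -/
def monomialMap (α β : ℂ) (δ γ d : ℕ) : ℂ × ℂ → ℂ × ℂ :=
  fun x => (α * x.1 ^ δ, β * x.1 ^ γ * x.2 ^ d)

/-- `φ` is a biholomorphic map from the open set `U` onto the open set `φ(U)`. -/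
def IsBiholomorphicOn (φ : ℂ × ℂ → ℂ × ℂ) (U : Set (ℂ × ℂ)) : Prop :=
  IsOpen U ∧ DifferentiableOn ℂ φ U ∧ IsOpen (φ '' U) ∧
    ∃ ψ : ℂ × ℂ → ℂ × ℂ, DifferentiableOn ℂ ψ (φ '' U) ∧ ∀ x ∈ U, ψ (φ x) = x

/-- `φ` is a biholomorphic map on `U`, extended by `φ(0) = 0`, that conjugates `f` to `f₀`.
`f` maps `U` to itself, except that it may send points of `U` on the line `z = 0` to the origin,
which need not belong to `U`. -/
structure IsBottcherOn (f f₀ : ℂ × ℂ → ℂ × ℂ) (U : Set (ℂ × ℂ)) (φ : ℂ × ℂ → ℂ × ℂ) : Prop where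
  invariant : ∀ x ∈ U, f x ∈ U ∨ (x.1 = 0 ∧ f x = 0)
  biholomorphic : IsBiholomorphicOn φ U
  map_zero : φ 0 = 0
  conj : ∀ x ∈ U, φ (f x) = f₀ (φ x)

end BottcherSkew

/-! On a small wedge the map has the form `f = (α z^δ (1 + ζ), β z^γ w (1 + η))` with `ζ = O(z)` and
`η = O(r^c)` on `U_r`. Indeed, by convexity of the Newton polygon, each monomial of `q` divided by
`z^γ w` is bounded on `U_r` by a power of `r` (`IsAdmissible.exists_eq_dominant_mul_one_add`). When
`d = 1`, the hypothesis `δ ≠ T_k` turns the weak inequalities defining the weights into the strict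
ones `l₁(δ - 1) < γ` and `γκ < (δ - 1)(l₁κ + 1)`. These gaps yield a factor `|z|^e` with `e > 0`, so
that `f` sends `U_r` into `U_{r/2}` off the line `z = 0` (`mem_wedge_of_comparable`).

The conjugacy is sought as `φ = (z exp s(z), w exp S(z, w))`. Taking logarithms, `φ ∘ f = f₀ ∘ φ`
becomes `δ s = log(1 + ζ) + s ∘ p` and `S + γ s = log(1 + η) + S ∘ f`. The first is solved by a
series with weights `δ^{-(N+1)}`. In the second the coefficient of `S` is `d = 1`, so no such
weights occur: `S = ∑ λ ∘ f^N` with `λ = log(1 + η) - γ s`, and it converges only because `λ =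
O((r/2^N)^c)` on `U_{r/2^N}`, which contains the `N`-th iterate. Hence `S = O(r^c)`, so `φ` is close
to the identity, and Cauchy estimates on vertical slices give injectivity.

Points of `U_r` with `z = 0` are sent to the origin, possibly outside the wedge. Holomorphy of `S`
across this line therefore comes from a removable singularity argument. For `δ = T_1`, the example
violates already the invariance of the wedge. -/

namespace BottcherSkew

open Set Filter Topology Metric

/-! ### Holomorphic functions of several variables. -/

section SeveralVariables

variable {E F : Type*} [NormedAddCommGroup E] [NormedSpace ℂ E] [NormedAddCommGroup F]
  [NormedSpace ℂ F]

/-- Cauchy's estimate for the derivative on a ball of a complex normed space. -/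
theorem norm_fderiv_le_of_norm_le_ball {f : E → F} {c : E} {R C : ℝ} (hR : 0 < R)
    (hd : DifferentiableOn ℂ f (ball c R)) (hb : ∀ x ∈ ball c R, ‖f x‖ ≤ C) :
    ‖fderiv ℂ f c‖ ≤ 2 * C / R := by
  refine Complex.norm_fderiv_le_div_of_mapsTo_ball hd (fun x hx => ?_) hR
  rw [mem_closedBall, dist_eq_norm, two_mul]
  exact (norm_sub_le _ _).trans (add_le_add (hb x hx) (hb c (mem_ball_self hR)))

/-- A normally convergent series of holomorphic functions on an open subset of a complex normed
space has a holomorphic sum. -/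
theorem differentiableOn_tsum_of_norm_le [CompleteSpace F] {ι : Type*} {f : ι → E → F} {u : ι → ℝ}
    {U : Set E}
    (hu : Summable u) (hU : IsOpen U) (hf : ∀ i, DifferentiableOn ℂ (f i) U)
    (hb : ∀ i, ∀ x ∈ U, ‖f i x‖ ≤ u i) : DifferentiableOn ℂ (fun x => ∑' i, f i x) U := by
  intro x hx
  obtain ⟨R, hR, hRU⟩ := Metric.isOpen_iff.1 hU x hx
  -- Halving the radius leaves around each `y` a ball on which Cauchy's estimate bounds the
  -- derivatives by a summable sequence, uniformly in `y`.
  have hsub : ∀ y ∈ ball x (R / 2), ball y (R / 2) ⊆ U := fun y hy =>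
    (ball_subset_ball' (by rw [mem_ball] at hy; linarith)).trans hRU
  have h := hasFDerivAt_tsum_of_isPreconnected (𝕜 := ℂ) (x₀ := x) (x := x) (f := f)
    (f' := fun i y => fderiv ℂ (f i) y) (u := fun i => 2 * u i / (R / 2))
    ((hu.mul_left 2).div_const (R / 2))
    (isOpen_ball (x := x) (ε := R / 2))
    (letI : NormedSpace ℝ E := NormedSpace.restrictScalars ℝ ℂ E
     (convex_ball x (R / 2)).isPreconnected)
    (fun i y hy => ((hf i).differentiableAt
      (hU.mem_nhds (hsub y hy (mem_ball_self (by positivity))))).hasFDerivAt)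
    (fun i y hy => norm_fderiv_le_of_norm_le_ball (by positivity) ((hf i).mono (hsub y hy))
      fun z hz => hb i z (hsub y hy hz))
    (mem_ball_self (by positivity))
    (Summable.of_norm_bounded hu fun i => hb i x hx)
    (mem_ball_self (by positivity))
  exact h.differentiableAt.differentiableWithinAt

/-- The derivative of a holomorphic map on an open subset of a complex normed space is
continuous. -/
theorem continuousAt_fderiv_of_differentiableOn {f : E → F} {U : Set E} (hU : IsOpen U)
    (hf : DifferentiableOn ℂ f U) {x : E} (hx : x ∈ U) : ContinuousAt (fderiv ℂ f) x := by
  have hc : ContinuousAt f x := hf.continuousOn.continuousAt (hU.mem_nhds hx)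
  have hbd : ∀ᶠ y in 𝓝 x, ‖f y‖ < ‖f x‖ + 1 :=
    hc.norm.eventually_lt_const (by linarith)
  obtain ⟨R, hR, hRU⟩ := Metric.mem_nhds_iff.1 (inter_mem (hU.mem_nhds hx) hbd)
  set C := ‖f x‖ + 1
  have hd : ∀ y ∈ ball x R, DifferentiableAt ℂ f y := fun y hy =>
    hf.differentiableAt (hU.mem_nhds (hRU hy).1)
  let : NormedSpace ℝ E := NormedSpace.restrictScalars ℝ ℂ E
  -- Lipschitz bound near `x`
  have hlip : ∀ y ∈ ball x (R / 2), ∀ z ∈ ball x (R / 2),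
      ‖f z - f y‖ ≤ 2 * C / (R / 2) * ‖z - y‖ := by
    intro y hy z hz
    refine (convex_ball x (R / 2)).norm_image_sub_le_of_norm_fderiv_le (𝕜 := ℂ)
      (fun u hu => hd u (ball_subset_ball (by linarith) hu)) (fun u hu => ?_) hy hz
    have hsub : ball u (R / 2) ⊆ ball x R := ball_subset_ball' (by
      rw [mem_ball] at hu; linarith)
    exact norm_fderiv_le_of_norm_le_ball (by positivity)
      (fun v hv => (hd v (hsub hv)).differentiableWithinAt)
      fun v hv => (hRU (hsub hv)).2.le
  have hdiff : ∀ᶠ y in 𝓝 x, ‖fderiv ℂ f y - fderiv ℂ f x‖ ≤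
      2 * (2 * C / (R / 2) * ‖y - x‖) / (R / 4) := by
    filter_upwards [ball_mem_nhds x (show 0 < R / 4 by positivity)] with y hy
    have hyx : ‖y - x‖ < R / 4 := by rwa [mem_ball, dist_eq_norm] at hy
    have hmem : ∀ v ∈ ball x (R / 4), v + (y - x) ∈ ball x (R / 2) := by
      intro v hv
      rw [mem_ball, dist_eq_norm] at hv ⊢
      calc ‖v + (y - x) - x‖ = ‖(v - x) + (y - x)‖ := by congr 1; abel
        _ ≤ _ := norm_add_le _ _
        _ < _ := by linarith
    have hs := ball_subset_ball (x := x) (show R / 4 ≤ R / 2 by linarith)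
    have hs' := ball_subset_ball (x := x) (show R / 2 ≤ R by linarith)
    have hx4 : x ∈ ball x (R / 4) := mem_ball_self (by positivity)
    have hdy : ∀ v ∈ ball x (R / 4), DifferentiableAt ℂ (fun v => f (v + (y - x))) v := by
      intro v hv
      exact (hd _ (hs' (hmem v hv))).comp v (differentiableAt_id.add_const _)
    -- The difference of `f` and its translate by `y - x` is `O(‖y - x‖)` on a fixed ball, and its
    -- derivative at `x` is `Df(y) - Df(x)`, to which Cauchy's estimate applies.
    have key := norm_fderiv_le_of_norm_le_ball (f := fun v => f (v + (y - x)) - f v)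
      (c := x) (R := R / 4) (C := 2 * C / (R / 2) * ‖y - x‖) (by positivity)
      (fun v hv => ((hdy v hv).sub (hd v (hs' (hs hv)))).differentiableWithinAt)
      (fun v hv => by
        simpa using hlip v (hs hv) _ (hmem v hv))
    rw [fderiv_fun_sub (hdy x hx4) (hd x (hs' (hs hx4))), fderiv_comp_add_right] at key
    simpa using key
  rw [ContinuousAt, tendsto_iff_norm_sub_tendsto_zero]
  refine squeeze_zero' (Eventually.of_forall fun _ => norm_nonneg _) hdiff ?_
  have : Tendsto (fun y : E => 2 * (2 * C / (R / 2) * ‖y - x‖) / (R / 4)) (𝓝 x)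
      (𝓝 (2 * (2 * C / (R / 2) * ‖x - x‖) / (R / 4))) := by
    apply Continuous.tendsto
    fun_prop
  simpa using this

/-- A holomorphic map on an open subset of a complex normed space is strictly differentiable. -/
theorem hasStrictFDerivAt_of_differentiableOn {f : E → F} {U : Set E} (hU : IsOpen U)
    (hf : DifferentiableOn ℂ f U) {x : E} (hx : x ∈ U) :
    HasStrictFDerivAt f (fderiv ℂ f x) x := by
  refine hasStrictFDerivAt_of_hasFDerivAt_of_continuousAt (f' := fderiv ℂ f) ?_
    (continuousAt_fderiv_of_differentiableOn hU hf hx)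
  filter_upwards [hU.mem_nhds hx] with y hy
  exact (hf.differentiableAt (hU.mem_nhds hy)).hasFDerivAt

end SeveralVariables

/-- Removable singularities along the line `z = 0`: a continuous function on an open subset of `ℂ²`
that is holomorphic off the line `z = 0` is holomorphic. -/
theorem differentiableOn_of_continuousOn_of_fst_ne_zero {g : ℂ × ℂ → ℂ} {U : Set (ℂ × ℂ)}
    (hU : IsOpen U) (hc : ContinuousOn g U)
    (hd : DifferentiableOn ℂ g (U ∩ {x | x.1 ≠ 0})) : DifferentiableOn ℂ g U := by
  have hV : IsOpen (U ∩ {x : ℂ × ℂ | x.1 ≠ 0}) :=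
    hU.inter (isOpen_ne.preimage continuous_fst)
  intro x hx
  by_cases hx0 : x.1 ≠ 0
  · exact (hd.differentiableAt (hV.mem_nhds ⟨hx, hx0⟩)).differentiableWithinAt
  push Not at hx0
  have hbd : ∀ᶠ y in 𝓝 x, ‖g y‖ < ‖g x‖ + 1 :=
    (hc.continuousAt (hU.mem_nhds hx)).norm.eventually_lt_const (by linarith)
  obtain ⟨ρ, hρ, hρU⟩ := Metric.mem_nhds_iff.1 (inter_mem (hU.mem_nhds hx) hbd)
  set C := ‖g x‖ + 1
  set R := ρ / 2 with hR
  have hR0 : 0 < R := by positivity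
  have hnorm : ∀ (θ : ℝ), ‖circleMap 0 R θ‖ = R := fun θ => by simp [hR0.le]
  -- As `x.1 = 0` and `|y.1| < R/4`, the circle of radius `R` about `y.1` stays at distance more
  -- than `3R/4` from `0`. Balls of radius `R/2` about its points therefore avoid the line `z = 0`.
  have hpt : ∀ y ∈ ball x (R / 4), ∀ θ : ℝ,
      ball (y.1 + circleMap 0 R θ, y.2) (R / 2) ⊆ (ball x ρ) ∩ {x : ℂ × ℂ | x.1 ≠ 0} := by
    intro y hy θ v hv
    rw [mem_ball, Prod.dist_eq, max_lt_iff, dist_eq_norm, dist_eq_norm] at hy hv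
    simp only at hv
    rw [hx0, sub_zero] at hy
    refine ⟨?_, fun h0 => ?_⟩
    · rw [mem_ball, Prod.dist_eq, max_lt_iff, dist_eq_norm, dist_eq_norm, hx0, sub_zero]
      constructor
      · calc ‖v.1‖ = ‖(v.1 - (y.1 + circleMap 0 R θ)) + y.1 + circleMap 0 R θ‖ := by
              congr 1; ring
          _ ≤ _ := norm_add₃_le
          _ < _ := by rw [hnorm]; linarith
      · calc ‖v.2 - x.2‖ = ‖(v.2 - y.2) + (y.2 - x.2)‖ := by congr 1; ring
          _ ≤ _ := norm_add_le _ _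
          _ < _ := by linarith
    · rw [h0] at hv
      have : ‖circleMap 0 R θ‖ ≤ ‖0 - (y.1 + circleMap 0 R θ)‖ + ‖y.1‖ := by
        rw [← norm_neg]
        calc _ = ‖(0 - (y.1 + circleMap 0 R θ)) + y.1‖ := by congr 1; ring
          _ ≤ _ := norm_add_le _ _
      rw [hnorm] at this
      linarith
  have hpt' : ∀ y ∈ ball x (R / 4), ∀ θ : ℝ,
      (y.1 + circleMap 0 R θ, y.2) ∈ U ∩ {x : ℂ × ℂ | x.1 ≠ 0} := fun y hy θ =>
    have h := hpt y hy θ (mem_ball_self (by positivity))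
    ⟨(hρU h.1).1, h.2⟩
  have hcont : ∀ y : ℂ × ℂ, Continuous fun θ : ℝ => (y.1 + circleMap 0 R θ, y.2) := fun y =>
    (continuous_const.add (continuous_circleMap 0 R)).prodMk continuous_const
  have hgd : ∀ v ∈ U ∩ {x : ℂ × ℂ | x.1 ≠ 0}, DifferentiableAt ℂ g v := fun v hv =>
    hd.differentiableAt (hV.mem_nhds hv)
  have hgc : ∀ y ∈ ball x (R / 4), Continuous fun θ : ℝ => g (y.1 + circleMap 0 R θ, y.2) :=
    fun y hy => continuous_iff_continuousAt.2 fun θ =>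
      ContinuousAt.comp (f := fun θ : ℝ => (y.1 + circleMap 0 R θ, y.2))
        (hgd _ (hpt' y hy θ)).continuousAt (hcont y).continuousAt
  have hxR : x ∈ ball x (R / 4) := mem_ball_self (by positivity)
  -- The circular mean of `g` in the first variable only sees points off the line, so it can be
  -- differentiated under the integral sign.
  have key := intervalIntegral.hasFDerivAt_integral_of_dominated_of_fderiv_le (𝕜 := ℂ)
    (μ := MeasureTheory.volume) (a := 0) (b := 2 * Real.pi)
    (F := fun (y : ℂ × ℂ) (θ : ℝ) => g (y.1 + circleMap 0 R θ, y.2))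
    (F' := fun (y : ℂ × ℂ) (θ : ℝ) => fderiv ℂ g (y.1 + circleMap 0 R θ, y.2))
    (x₀ := x) (bound := fun _ => 2 * C / (R / 2))
    (ball_mem_nhds x (show 0 < R / 4 by positivity))
    (by
      filter_upwards [ball_mem_nhds x (show 0 < R / 4 by positivity)] with y hy
      exact (hgc y hy).aestronglyMeasurable)
    ((hgc x hxR).intervalIntegrable _ _)
    (by
      refine Continuous.aestronglyMeasurable (continuous_iff_continuousAt.2 fun θ => ?_)
      refine ContinuousAt.comp (f := fun θ : ℝ => (x.1 + circleMap 0 R θ, x.2))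
        (g := fderiv ℂ g) ?_ (hcont x).continuousAt
      exact continuousAt_fderiv_of_differentiableOn hV hd (hpt' x hxR θ))
    (Eventually.of_forall fun θ _ y hy => norm_fderiv_le_of_norm_le_ball (by positivity)
      (fun v hv => (hgd v ⟨(hρU (hpt y hy θ hv).1).1, (hpt y hy θ hv).2⟩).differentiableWithinAt)
      fun v hv => (hρU (hpt y hy θ hv).1).2.le)
    intervalIntegrable_const
    (Eventually.of_forall fun θ _ y hy => by
      have h1 := (hgd _ (hpt' y hy θ)).hasFDerivAt
      have h2 : HasFDerivAt (fun y : ℂ × ℂ => (y.1 + circleMap 0 R θ, y.2))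
          (ContinuousLinearMap.id ℂ (ℂ × ℂ)) y :=
        ((hasFDerivAt_fst (𝕜 := ℂ) (p := y)).add_const _).prodMk hasFDerivAt_snd
      have h3 := HasFDerivAt.comp (g := g) y h1 h2
      rw [ContinuousLinearMap.comp_id] at h3
      exact h3)
  have hmean : ∀ᶠ y in 𝓝 x, g y =
      ((2 * Real.pi)⁻¹ : ℝ) • ∫ θ in (0 : ℝ)..2 * Real.pi, g (y.1 + circleMap 0 R θ, y.2) := by
    filter_upwards [ball_mem_nhds x (show 0 < R / 4 by positivity)] with y hy
    have hline : ∀ z ∈ closedBall y.1 R, (z, y.2) ∈ ball x ρ := by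
      intro z hz
      rw [mem_ball, Prod.dist_eq, max_lt_iff] at hy ⊢
      rw [mem_closedBall] at hz
      exact ⟨(dist_triangle _ y.1 _).trans_lt (by linarith), by linarith⟩
    -- The mean value property tolerates the single exceptional point `z = 0` of the disc, since `g`
    -- is continuous there. So `g` equals its circular mean near `x`.
    have hm := circleAverage_of_differentiable_on_off_countable (f := fun z => g (z, y.2))
      (c := y.1) (R := R) (s := {0}) (countable_singleton _)
      (by
        rw [abs_of_pos hR0]
        intro z hz
        exact (ContinuousAt.comp (f := fun z : ℂ => (z, y.2))
          (hc.continuousAt (hU.mem_nhds (hρU (hline z hz)).1))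
          (by fun_prop)).continuousWithinAt)
      (by
        rw [abs_of_pos hR0]
        intro z hz
        exact DifferentiableAt.comp (f := fun z : ℂ => (z, y.2)) z
          (hgd _ ⟨(hρU (hline z (ball_subset_closedBall hz.1))).1, hz.2⟩) (by fun_prop))
    rw [Real.circleAverage_def] at hm
    rw [show g y = g (y.1, y.2) from rfl, ← hm]
    simp [circleMap]
  have h3 := (key.const_smul ((2 * Real.pi)⁻¹ : ℝ)).congr_of_eventuallyEq hmean
  exact h3.differentiableAt.differentiableWithinAt

end BottcherSkew

/-! ### The Newton polygon and the inequalities it gives. -/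

namespace BottcherSkew

open Set

section NewtonPolygon

variable {b : ℕ → ℕ → ℂ}

theorem mem_newtonPolygon_of_coeff_ne_zero {i j : ℕ} (hb : b i j ≠ 0) :
    ((i : ℝ), (j : ℝ)) ∈ newtonPolygon b :=
  subset_convexHull ℝ _ ⟨i, j, hb, le_rfl, le_rfl⟩

theorem newtonPolygon_add_mem {v w : ℝ × ℝ} (hv : v ∈ newtonPolygon b) (hw : 0 ≤ w) :
    v + w ∈ newtonPolygon b := by
  have hconv : Convex ℝ ((fun z => z + w) ⁻¹' newtonPolygon b) :=
    (convex_convexHull ℝ _).translate_preimage_left w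
  refine convexHull_min (fun u hu => ?_) hconv hv
  obtain ⟨i, j, hb, hi, hj⟩ := hu
  have h1 := hw.1
  have h2 := hw.2
  simp only [Prod.fst_zero, Prod.snd_zero] at h1 h2
  exact subset_convexHull ℝ _ ⟨i, j, hb, by simp; linarith, by simp; linarith⟩

/-- Each point of a quadrant is the midpoint of the corner and of the corner's reflection in it,
which lies in the same quadrant. So only corners can be extreme. -/
theorem exists_coeff_ne_zero_of_mem_extremePoints {v : ℝ × ℝ}
    (h : v ∈ (newtonPolygon b).extremePoints ℝ) :
    ∃ i j : ℕ, b i j ≠ 0 ∧ v = ((i : ℝ), (j : ℝ)) := by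
  obtain ⟨i, j, hb, hi, hj⟩ := extremePoints_convexHull_subset h
  have h1 : ((2 * v.1 - i, 2 * v.2 - j) : ℝ × ℝ) ∈ newtonPolygon b :=
    subset_convexHull ℝ _ ⟨i, j, hb, by simp only; linarith, by simp only; linarith⟩
  exact ⟨i, j, hb, (h.2 (mem_newtonPolygon_of_coeff_ne_zero hb) h1
    ⟨1/2, 1/2, by norm_num, by norm_num, by norm_num, by ext <;> simp <;> ring⟩).symm⟩

theorem coeff_ne_zero_of_mem_extremePoints {i j : ℕ}
    (h : ((i : ℝ), (j : ℝ)) ∈ (newtonPolygon b).extremePoints ℝ) : b i j ≠ 0 := by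
  obtain ⟨i', j', hb, e⟩ := exists_coeff_ne_zero_of_mem_extremePoints h
  simp only [Prod.mk.injEq, Nat.cast_inj] at e
  rwa [e.1, e.2]

/-- An extreme point of the Newton polygon does not lie strictly above a chord. -/
theorem snd_le_of_mem_extremePoints {u v w : ℝ × ℝ} {s t : ℝ} (hu : u ∈ newtonPolygon b)
    (hv : v ∈ newtonPolygon b) (hw : w ∈ (newtonPolygon b).extremePoints ℝ) (hs : 0 ≤ s)
    (ht : 0 ≤ t) (hst : s + t = 1) (h1 : w.1 = s * u.1 + t * v.1) :
    w.2 ≤ s * u.2 + t * v.2 := by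
  by_contra! hlt
  have hP : s • u + t • v ∈ newtonPolygon b := convex_convexHull ℝ _ hu hv hs ht hst
  -- The reflection in `w` of the chord point below it. It lies above the chord, hence in the
  -- polygon, and `w` would be an interior point of a segment.
  have hQ : s • u + t • v + ((0, 2 * (w.2 - (s * u.2 + t * v.2))) : ℝ × ℝ) ∈ newtonPolygon b :=
    newtonPolygon_add_mem hP ⟨le_rfl, by simp; linarith⟩
  have := hw.2 hP hQ ⟨1/2, 1/2, by norm_num, by norm_num, by norm_num, by
    ext
    · simp [h1]; ring
    · simp; ring⟩
  have h2 := congrArg Prod.snd this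
  simp at h2
  linarith

/-- A lexicographic minimiser over the support of two independent nonnegative linear forms is a
vertex of the Newton polygon. -/
theorem mem_extremePoints_of_lex_min {α β α' β' : ℝ} (hα : 0 ≤ α) (hβ : 0 ≤ β) (hα' : 0 ≤ α')
    (hβ' : 0 ≤ β') (hdet : α * β' - α' * β ≠ 0) {i j : ℕ} (hb : b i j ≠ 0)
    (hmin : ∀ i' j' : ℕ, b i' j' ≠ 0 → α * i + β * j < α * i' + β * j' ∨
      (α * i + β * j = α * i' + β * j' ∧ α' * i + β' * j ≤ α' * i' + β' * j')) :
    ((i : ℝ), (j : ℝ)) ∈ (newtonPolygon b).extremePoints ℝ := by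
  set μ := α * i + β * j with hμ
  set μ' := α' * i + β' * j with hμ'
  -- An open half-plane together with a closed ray of its boundary line. It is convex and contains
  -- all quadrants, hence the polygon.
  set H : Set (ℝ × ℝ) := {u | μ < α * u.1 + β * u.2 ∨
    (μ = α * u.1 + β * u.2 ∧ μ' ≤ α' * u.1 + β' * u.2)} with hH
  have hconv : Convex ℝ H := by
    rw [convex_iff_forall_pos]
    intro u hu v hv s t hs ht hst
    have e1 : α * (s • u + t • v).1 + β * (s • u + t • v).2 =
        s * (α * u.1 + β * u.2) + t * (α * v.1 + β * v.2) := by simp; ring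
    have e2 : α' * (s • u + t • v).1 + β' * (s • u + t • v).2 =
        s * (α' * u.1 + β' * u.2) + t * (α' * v.1 + β' * v.2) := by simp; ring
    have e3 : μ = s * μ + t * μ := by rw [← add_mul, hst, one_mul]
    have e4 : μ' = s * μ' + t * μ' := by rw [← add_mul, hst, one_mul]
    simp only [hH, mem_ofPred_eq] at hu hv ⊢
    rw [e1, e2]
    rcases hu with hu | ⟨hu, hu'⟩ <;> rcases hv with hv | ⟨hv, hv'⟩
    · left
      have := mul_lt_mul_of_pos_left hu hs
      have := mul_lt_mul_of_pos_left hv ht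
      linarith
    · left
      have := mul_lt_mul_of_pos_left hu hs
      rw [← hv]; linarith
    · left
      have := mul_lt_mul_of_pos_left hv ht
      rw [← hu]; linarith
    · right
      have := mul_le_mul_of_nonneg_left hu' hs.le
      have := mul_le_mul_of_nonneg_left hv' ht.le
      rw [← hu, ← hv]
      exact ⟨e3, by linarith⟩
  have hsub : newtonPolygon b ⊆ H := by
    refine convexHull_min (fun u hu => ?_) hconv
    obtain ⟨i', j', hb', hi, hj⟩ := hu
    have h1 := mul_le_mul_of_nonneg_left hi hα
    have h2 := mul_le_mul_of_nonneg_left hj hβ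
    have h3 := mul_le_mul_of_nonneg_left hi hα'
    have h4 := mul_le_mul_of_nonneg_left hj hβ'
    rcases hmin i' j' hb' with h | ⟨h, h'⟩
    · left; linarith
    · rcases (show μ ≤ α * u.1 + β * u.2 by linarith).lt_or_eq with h5 | h5
      · left; exact h5
      · right; exact ⟨h5, by linarith⟩
  refine ⟨mem_newtonPolygon_of_coeff_ne_zero hb, ?_⟩
  rintro u hu v hv ⟨s, t, hs, ht, hst, huv⟩
  have e1 : s * u.1 + t * v.1 = i := by simpa using congrArg Prod.fst huv
  have e2 : s * u.2 + t * v.2 = j := by simpa using congrArg Prod.snd huv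
  have k1 : s * (α * u.1 + β * u.2 - μ) + t * (α * v.1 + β * v.2 - μ) = 0 := by
    linear_combination α * e1 + β * e2 + hμ - μ * hst
  have k2 : s * (α' * u.1 + β' * u.2 - μ') + t * (α' * v.1 + β' * v.2 - μ') = 0 := by
    linear_combination α' * e1 + β' * e2 + hμ' - μ' * hst
  have hge : ∀ u ∈ H, 0 ≤ α * u.1 + β * u.2 - μ := by
    rintro u (h | ⟨h, -⟩) <;> linarith
  have hge' : ∀ u ∈ H, α * u.1 + β * u.2 - μ = 0 → 0 ≤ α' * u.1 + β' * u.2 - μ' := by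
    rintro u (h | ⟨-, h⟩) h0 <;> linarith
  have huge := hge u (hsub hu)
  have hvge := hge v (hsub hv)
  -- On a segment through `(i, j)` inside `H` the first form must be minimal at both ends. Then the
  -- second form is minimal too, and independence of the two forms pins the end down.
  have hu0 : α * u.1 + β * u.2 - μ = 0 := by
    have := mul_nonneg hs.le huge
    have := mul_nonneg ht.le hvge
    exact (mul_eq_zero.1 (by linarith : s * (α * u.1 + β * u.2 - μ) = 0)).resolve_left hs.ne'
  have hv0 : α * v.1 + β * v.2 - μ = 0 := by
    rw [hu0] at k1
    exact (mul_eq_zero.1 (by linarith : t * (α * v.1 + β * v.2 - μ) = 0)).resolve_left ht.ne'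
  have hu0' : α' * u.1 + β' * u.2 - μ' = 0 := by
    have := mul_nonneg hs.le (hge' u (hsub hu) hu0)
    have := mul_nonneg ht.le (hge' v (hsub hv) hv0)
    exact (mul_eq_zero.1 (by linarith : s * (α' * u.1 + β' * u.2 - μ') = 0)).resolve_left hs.ne'
  ext
  · apply mul_left_cancel₀ hdet
    linear_combination β' * hu0 - β * hu0' + β' * hμ - β * hμ'
  · apply mul_left_cancel₀ hdet
    linear_combination α * hu0' - α' * hu0 + α * hμ' - α' * hμ

/-- Two independent nonnegative linear forms with integer coefficients have a lexicographic
minimiser over the support, which is a vertex of the Newton polygon. -/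
theorem exists_mem_extremePoints_lex_min (α β α' β' : ℕ)
    (hdet : (α : ℝ) * β' - α' * β ≠ 0) {i₀ j₀ : ℕ} (hb : b i₀ j₀ ≠ 0) :
    ∃ i j : ℕ, ((i : ℝ), (j : ℝ)) ∈ (newtonPolygon b).extremePoints ℝ ∧
      ∀ i' j' : ℕ, b i' j' ≠ 0 → α * i + β * j ≤ α * i' + β * j' := by
  let F : ℕ × ℕ → ℕ ×ₗ ℕ := fun v => toLex (α * v.1 + β * v.2, α' * v.1 + β' * v.2)
  obtain ⟨v, hv, hmin⟩ := (InvImage.wf F wellFounded_lt).has_min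
    {v : ℕ × ℕ | b v.1 v.2 ≠ 0} ⟨(i₀, j₀), hb⟩
  have hmin' : ∀ i' j' : ℕ, b i' j' ≠ 0 → α * v.1 + β * v.2 < α * i' + β * j' ∨
      (α * v.1 + β * v.2 = α * i' + β * j' ∧ α' * v.1 + β' * v.2 ≤ α' * i' + β' * j') := by
    intro i' j' h
    have h1 := not_lt.1 (hmin (i', j') h)
    simpa [F, Prod.Lex.le_iff] using h1
  refine ⟨v.1, v.2, mem_extremePoints_of_lex_min (Nat.cast_nonneg α) (Nat.cast_nonneg β)
    (Nat.cast_nonneg α') (Nat.cast_nonneg β') hdet hv fun i' j' h => ?_, fun i' j' h => ?_⟩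
  · exact_mod_cast hmin' i' j' h
  · rcases hmin' i' j' h with h | h
    · exact h.le
    · exact h.1.le

variable {s : ℕ} {n m : ℕ → ℕ}

theorem IsVertexList.mem_extremePoints (h : IsVertexList b s n m) {k : ℕ} (hk : k ∈ Icc 1 s) :
    ((n k : ℝ), (m k : ℝ)) ∈ (newtonPolygon b).extremePoints ℝ := by
  rw [h.vertices]; exact ⟨k, hk, rfl⟩

theorem IsVertexList.exists_eq (h : IsVertexList b s n m) {i j : ℕ}
    (hij : ((i : ℝ), (j : ℝ)) ∈ (newtonPolygon b).extremePoints ℝ) :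
    ∃ k ∈ Icc 1 s, n k = i ∧ m k = j := by
  rw [h.vertices] at hij
  obtain ⟨k, hk, e⟩ := hij
  simp only [Prod.mk.injEq, Nat.cast_inj] at e
  exact ⟨k, hk, e⟩

theorem IsVertexList.first_le (h : IsVertexList b s n m) {i j : ℕ} (hb : b i j ≠ 0) : n 1 ≤ i := by
  obtain ⟨i', j', he, hmin⟩ := exists_mem_extremePoints_lex_min 1 0 0 1 (by norm_num) hb
  obtain ⟨k, hk, rfl, rfl⟩ := h.exists_eq he
  have h1 := hmin i j hb
  have h2 : n 1 ≤ n k := h.strictMono.monotoneOn ⟨le_rfl, hk.1.trans hk.2⟩ hk hk.1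
  omega

theorem IsVertexList.last_le (h : IsVertexList b s n m) {i j : ℕ} (hb : b i j ≠ 0) : m s ≤ j := by
  obtain ⟨i', j', he, hmin⟩ := exists_mem_extremePoints_lex_min 0 1 1 0 (by norm_num) hb
  obtain ⟨k, hk, rfl, rfl⟩ := h.exists_eq he
  have h1 := hmin i j hb
  have h2 : m s ≤ m k := h.strictAnti.antitoneOn hk ⟨hk.1.trans hk.2, le_rfl⟩ hk.2
  omega

/-- The line through two consecutive vertices supports the Newton polygon. -/
theorem IsVertexList.edge_le (h : IsVertexList b s n m) {k : ℕ} (hk : 1 ≤ k) (hks : k + 1 ≤ s)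
    {i j : ℕ} (hb : b i j ≠ 0) :
    ((m k : ℝ) - m (k + 1)) * n k + ((n (k + 1) : ℝ) - n k) * m k ≤
      ((m k : ℝ) - m (k + 1)) * i + ((n (k + 1) : ℝ) - n k) * j := by
  have hk1 : k ∈ Icc 1 s := ⟨hk, by omega⟩
  have hk2 : k + 1 ∈ Icc 1 s := ⟨by omega, hks⟩
  have hn : n k < n (k + 1) := h.strictMono hk1 hk2 (by omega)
  have hm : m (k + 1) < m k := h.strictAnti hk1 hk2 (by omega)
  have hn' : (0 : ℝ) < (n (k + 1) : ℝ) - n k := sub_pos.2 (Nat.cast_lt.2 hn)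
  have hm' : (0 : ℝ) < (m k : ℝ) - m (k + 1) := sub_pos.2 (Nat.cast_lt.2 hm)
  -- The form is normal to the edge. The second form `(1, 0)` only breaks ties, and independence
  -- amounts to `n k ≠ n (k + 1)`.
  obtain ⟨i', j', he, hmin⟩ := exists_mem_extremePoints_lex_min (m k - m (k + 1))
    (n (k + 1) - n k) 1 0 (by rw [Nat.cast_sub hn.le]; simpa [sub_eq_zero] using hn.ne) hb
  have hmin' : ((m k : ℝ) - m (k + 1)) * i' + ((n (k + 1) : ℝ) - n k) * j' ≤
      ((m k : ℝ) - m (k + 1)) * i + ((n (k + 1) : ℝ) - n k) * j := by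
    have := hmin i j hb
    rw [← Nat.cast_sub hn.le, ← Nat.cast_sub hm.le]
    exact_mod_cast this
  refine le_trans ?_ hmin'
  obtain ⟨l, hl, rfl, rfl⟩ := h.exists_eq he
  -- A vertex `l` strictly below the edge line contradicts extremality. If `l < k`, vertex `k` lies
  -- above the chord from `l` to `k + 1`; if `l > k + 1`, vertex `k + 1` lies above the chord from
  -- `k` to `l`.
  by_contra! hlt
  set α := (m k : ℝ) - m (k + 1) with hα
  set β := (n (k + 1) : ℝ) - n k with hβ
  have hsame : α * n k + β * m k = α * n (k + 1) + β * m (k + 1) := by rw [hα, hβ]; ring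
  rcases lt_trichotomy l k with hlk | rfl | hlk
  · have hnl : (n l : ℝ) < n k := Nat.cast_lt.2 (h.strictMono hl hk1 hlk)
    have hD : (0 : ℝ) < n (k + 1) - n l := by linarith
    have key := snd_le_of_mem_extremePoints (s := (n (k + 1) - n k) / (n (k + 1) - n l))
      (t := (n k - n l) / (n (k + 1) - n l)) he.1 (h.mem_extremePoints hk2).1
      (h.mem_extremePoints hk1) (by positivity) (div_nonneg (by linarith) hD.le)
      (by field_simp; ring) (by simp only; field_simp; ring)
    simp only at key
    rw [div_mul_eq_mul_div, div_mul_eq_mul_div, ← add_div, le_div_iff₀ hD] at key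
    have h1 := mul_lt_mul_of_pos_left hlt hn'
    have h2 := mul_le_mul_of_nonneg_left key hn'.le
    nlinarith [mul_pos hn' hm']
  · exact lt_irrefl _ hlt
  · rcases (show k + 1 ≤ l from hlk).eq_or_lt with rfl | hlk
    · linarith
    have hnl : (n (k + 1) : ℝ) < n l := Nat.cast_lt.2 (h.strictMono hk2 hl hlk)
    have hD : (0 : ℝ) < n l - n k := by linarith
    have key := snd_le_of_mem_extremePoints (s := (n l - n (k + 1)) / (n l - n k))
      (t := (n (k + 1) - n k) / (n l - n k)) (h.mem_extremePoints hk1).1 he.1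
      (h.mem_extremePoints hk2) (div_nonneg (by linarith) hD.le) (by positivity)
      (by field_simp; ring) (by simp only; field_simp; ring)
    simp only at key
    rw [div_mul_eq_mul_div, div_mul_eq_mul_div, ← add_div, le_div_iff₀ hD] at key
    have h1 := mul_lt_mul_of_pos_left hlt hn'
    have h2 := mul_le_mul_of_nonneg_left key hn'.le
    nlinarith [mul_pos hn' hm']

end NewtonPolygon

/-- The inequalities between the degree `δ`, the dominant exponent `(γ, 1)`, the weights and the
support of the power series that make the wedge attracted to the origin and the term
`b γ 1 z ^ γ w` dominant there. -/
structure IsAdmissible (b : ℕ → ℕ → ℂ) (δ γ : ℕ) (l₁ κ : ℝ) : Prop where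
  one_le : 1 ≤ γ
  l₁_nonneg : 0 ≤ l₁
  κ_nonneg : 0 ≤ κ
  coeff_ne_zero : b γ 1 ≠ 0
  fst_lt : l₁ * ((δ : ℝ) - 1) < γ
  snd_lt : γ * κ < ((δ : ℝ) - 1) * (l₁ * κ + 1)
  le_of_one_le : ∀ i j : ℕ, b i j ≠ 0 → 1 ≤ j → (γ : ℝ) ≤ i + l₁ * ((j : ℝ) - 1)
  le_of_eq_zero : ∀ i : ℕ, b i 0 ≠ 0 → 0 < κ ∧ (γ : ℝ) + l₁ + κ⁻¹ ≤ i

/-- The two edges at `(γ, 1)` support the polygon, which gives the inequalities for the exponents.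
Comparing `δ` with their intercepts gives the inequalities for the weights, strict because `δ` is
never an intercept. -/
theorem IsDominantData.isAdmissible {b : ℕ → ℕ → ℂ} {δ s : ℕ} {n m : ℕ → ℕ} {γ d : ℕ} {l₁ κ : ℝ}
    (hδ : 2 ≤ δ) (hb01 : b 0 1 = 0) (hv : IsVertexList b s n m)
    (hdata : IsDominantData δ s n m γ d l₁ κ) (hd : d = 1)
    (hT : ∀ k, 1 ≤ k → k + 1 ≤ s → (δ : ℝ) ≠ intercept n m k) : IsAdmissible b δ γ l₁ κ := by
  have hδ' : (0 : ℝ) < (δ : ℝ) - 1 := by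
    have : (2 : ℝ) ≤ δ := by exact_mod_cast hδ
    linarith
  -- the vertex `(γ, 1)`
  obtain ⟨k, hk, rfl, hmk⟩ : ∃ k ∈ Icc 1 s, n k = γ ∧ m k = 1 := by
    subst hd
    rcases hdata with h | h | h | ⟨k, h⟩
    · exact ⟨1, ⟨le_rfl, h.1.ge⟩, h.2.1.symm, h.2.2.1.symm⟩
    · exact ⟨s, ⟨h.1.le, le_rfl⟩, h.2.2.1.symm, h.2.2.2.1.symm⟩
    · exact ⟨1, ⟨le_rfl, h.1.le⟩, h.2.2.1.symm, h.2.2.2.1.symm⟩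
    · exact ⟨k, ⟨by omega, by omega⟩, h.2.2.2.2.1.symm, h.2.2.2.2.2.1.symm⟩
  have hcoeff : b (n k) 1 ≠ 0 := by
    have := coeff_ne_zero_of_mem_extremePoints (hv.mem_extremePoints hk)
    rwa [hmk] at this
  have hγ : 1 ≤ n k := by
    rcases Nat.eq_zero_or_pos (n k) with h0 | h0
    · rw [h0] at hcoeff; exact absurd hb01 hcoeff
    · exact h0
  have hγ' : (0 : ℝ) < n k := by exact_mod_cast hγ
  have hinj : ∀ l ∈ Icc 1 s, m l = 1 → l = k := fun l hl h =>
    hv.strictAnti.injOn hl hk (h.trans hmk.symm)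
  subst hd
  -- the edge on the left of the vertex
  have hleft : ∀ l, 1 ≤ l → l + 1 = k → (δ : ℝ) ≤ intercept n m l → 0 < weight n m l k ∧
      weight n m l k * ((δ : ℝ) - 1) < n k ∧
      ∀ i j : ℕ, b i j ≠ 0 → (n k : ℝ) ≤ i + weight n m l k * ((j : ℝ) - 1) := by
    rintro l hl rfl hle
    have hlt := lt_of_le_of_ne hle (hT l hl hk.2)
    have hn : (n l : ℝ) < n (l + 1) :=
      Nat.cast_lt.2 (hv.strictMono ⟨hl, by have := hk.2; omega⟩ hk (by omega))
    have hm : (m (l + 1) : ℝ) < m l :=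
      Nat.cast_lt.2 (hv.strictAnti ⟨hl, by have := hk.2; omega⟩ hk (by omega))
    have hmk' : (m (l + 1) : ℝ) = 1 := by exact_mod_cast hmk
    have hn' := sub_pos.2 hn
    have hm' := sub_pos.2 hm
    refine ⟨div_pos hn' hm', ?_, fun i j hij => ?_⟩
    · rw [weight, div_mul_eq_mul_div, div_lt_iff₀ hm']
      -- The edge passes through a vertex of height `1`, so its intercept is `1 + n (l + 1) /
      -- weight`, and `δ` below it means `weight * (δ - 1) < n (l + 1)`.
      have e : intercept n m l = 1 + n (l + 1) * (((m l : ℝ) - m (l + 1)) /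
          ((n (l + 1) : ℝ) - n l)) := by
        rw [intercept]; field_simp; rw [hmk']; ring
      rw [e, ← sub_lt_iff_lt_add', mul_div_assoc', lt_div_iff₀ hn'] at hlt
      linarith
    · have := hv.edge_le hl hk.2 hij
      rw [weight, div_mul_eq_mul_div, ← sub_le_iff_le_add', le_div_iff₀ hm']
      rw [hmk'] at this ⊢
      linarith
  -- the edge on the right of the vertex
  have hright : k + 1 ≤ s → intercept n m k ≤ (δ : ℝ) → 0 < weight n m k (k + 1) ∧
      (n k : ℝ) < ((δ : ℝ) - 1) * weight n m k (k + 1) ∧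
      ∀ i : ℕ, b i 0 ≠ 0 → (n k : ℝ) + weight n m k (k + 1) ≤ i := by
    intro hks hle
    have hlt := lt_of_le_of_ne hle (hT k hk.1 hks).symm
    have hn : (n k : ℝ) < n (k + 1) :=
      Nat.cast_lt.2 (hv.strictMono hk ⟨by omega, hks⟩ (by omega))
    have hm : (m (k + 1) : ℝ) < m k :=
      Nat.cast_lt.2 (hv.strictAnti hk ⟨by omega, hks⟩ (by omega))
    have hmk' : (m k : ℝ) = 1 := by exact_mod_cast hmk
    have hn' := sub_pos.2 hn
    have hm' := sub_pos.2 hm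
    refine ⟨div_pos hn' hm', ?_, fun i hij => ?_⟩
    · rw [weight, mul_div_assoc', lt_div_iff₀ hm']
      rw [intercept, hmk', ← lt_sub_iff_add_lt', mul_div_assoc', div_lt_iff₀ hn'] at hlt
      rw [hmk']
      linarith
    · have := hv.edge_le hk.1 hks hij
      rw [weight, ← le_sub_iff_add_le', div_le_iff₀ hm']
      rw [hmk'] at this ⊢
      push_cast at this
      linarith
  have hfirst : k = 1 → ∀ i j : ℕ, b i j ≠ 0 → 1 ≤ j →
      (n k : ℝ) ≤ i + (0 : ℝ) * ((j : ℝ) - 1) := by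
    rintro rfl i j hij -
    rw [zero_mul, add_zero]
    exact_mod_cast hv.first_le hij
  -- If the lowest vertex has height `1`, then `q` contains no pure power of `z`.
  have hlast : k = s → ∀ i : ℕ, b i 0 ≠ 0 → False := by
    rintro rfl i hi
    have := hv.last_le hi
    omega
  rcases hdata with ⟨hs, -, hm1, rfl, rfl⟩ | ⟨hs, hle, -, hm1, rfl, rfl⟩ |
    ⟨hs, hle, -, hm1, rfl, rfl⟩ | ⟨l, hl2, hls, hle1, hle2, -, hm1, rfl, l₂, hl₂, rfl⟩
  · have hk1 : k = 1 := by have := hk.1; have := hk.2; omega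
    exact ⟨hγ, le_rfl, le_rfl, hcoeff, by simpa using hγ', by simpa using hδ', hfirst hk1,
      fun i hi => (hlast (by omega) i hi).elim⟩
  · obtain rfl := hinj s ⟨by omega, le_rfl⟩ hm1.symm
    obtain ⟨h1, h2, h3⟩ := hleft (s - 1) (by omega) (by omega) hle
    exact ⟨hγ, h1.le, le_rfl, hcoeff, h2, by simpa using hδ', fun i j hij _ => h3 i j hij,
      fun i hi => (hlast rfl i hi).elim⟩
  · obtain rfl := hinj 1 ⟨le_rfl, by omega⟩ hm1.symm
    obtain ⟨h1, h2, h3⟩ := hright (by omega) hle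
    refine ⟨hγ, le_rfl, (inv_pos.2 h1).le, hcoeff, by simpa using hγ', ?_, hfirst rfl,
      fun i hi => ⟨inv_pos.2 h1, ?_⟩⟩
    · rw [zero_mul, zero_add, mul_one, ← div_eq_mul_inv, div_lt_iff₀ h1]
      exact h2
    · rw [inv_inv, add_zero]
      exact h3 i hi
  · obtain rfl := hinj l ⟨by omega, by omega⟩ hm1.symm
    obtain ⟨h1, h2, h3⟩ := hleft (l - 1) (by omega) (by omega) hle2
    obtain ⟨h4, h5, h6⟩ := hright hls hle1
    -- Multiplied by `δ - 1`, the left weight is less than `γ` and the right weight greater, so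
    -- their difference `l₂` is positive.
    have hl₂pos : 0 < l₂ := by
      by_contra! hcon
      have : weight n m l (l + 1) ≤ weight n m (l - 1) l := by linarith
      have := mul_le_mul_of_nonneg_left this hδ'.le
      linarith
    refine ⟨hγ, h1.le, (inv_pos.2 hl₂pos).le, hcoeff, h2, ?_, fun i j hij _ => h3 i j hij,
      fun i hi => ⟨inv_pos.2 hl₂pos, ?_⟩⟩
    · have e : ((δ : ℝ) - 1) * (weight n m (l - 1) l * l₂⁻¹ + 1) =
          (((δ : ℝ) - 1) * (weight n m (l - 1) l + l₂)) * l₂⁻¹ := by field_simp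
      rw [e, hl₂]
      exact mul_lt_mul_of_pos_right h5 (inv_pos.2 hl₂pos)
    · rw [inv_inv, add_assoc, hl₂]
      exact h6 i hi

end BottcherSkew

/-! ### The resonant example `δ = T_1`. -/

namespace BottcherSkew

open Set

/-- The coefficients of `z ^ γ w + z ^ (2 γ)`. -/
noncomputable def resonantCoeff (γ : ℕ) (i j : ℕ) : ℂ :=
  if (i = γ ∧ j = 1) ∨ (i = 2 * γ ∧ j = 0) then 1 else 0

theorem resonantCoeff_ne_zero {γ i j : ℕ} :
    resonantCoeff γ i j ≠ 0 ↔ (i = γ ∧ j = 1) ∨ (i = 2 * γ ∧ j = 0) := by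
  unfold resonantCoeff
  split_ifs with h <;> simp [h]

theorem isSuperattractingSkewProduct_resonant {γ : ℕ} (hγ : 1 ≤ γ) :
    IsSuperattractingSkewProduct (fun z => z ^ 2) (fun x => x.1 ^ γ * x.2 + x.1 ^ (2 * γ))
      (fun i => if i = 2 then 1 else 0) (resonantCoeff γ) 2 where
  series_fst := ⟨1, one_pos, fun z _ => by
    simpa using hasSum_single (f := fun i : ℕ => (if i = 2 then (1 : ℂ) else 0) * z ^ i) 2
      (fun i hi => by simp [hi])⟩
  series_snd := ⟨1, one_pos, fun z w _ _ => by
    have h := hasSum_sum_of_ne_finset_zero (L := SummationFilter.unconditional (ℕ × ℕ))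
      (f := fun ij : ℕ × ℕ => resonantCoeff γ ij.1 ij.2 * z ^ ij.1 * w ^ ij.2)
      (s := {(γ, 1), (2 * γ, 0)}) (fun ij hij => by
        have : resonantCoeff γ ij.1 ij.2 = 0 := by
          by_contra hne
          rcases resonantCoeff_ne_zero.1 hne with h | h <;>
            simp [Prod.ext_iff, h.1, h.2] at hij
        simp [this])
    rw [Finset.sum_pair (by simp)] at h
    simpa [resonantCoeff] using h⟩
  two_le := le_rfl
  coeff_ne_zero := by simp
  coeff_eq_zero := fun i hi => by simp [hi.ne]
  fixed := by simp [resonantCoeff]; omega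
  eigenvalue := by simp [resonantCoeff]; omega

theorem isVertexList_resonant {γ : ℕ} (hγ : 1 ≤ γ) :
    IsVertexList (resonantCoeff γ) 2 (fun k => k * γ) (fun k => 2 - k) where
  strictMono := fun i _ j _ hij => Nat.mul_lt_mul_of_pos_right hij hγ
  strictAnti := fun i hi j hj hij => by
    have := hi.1; have := hj.2
    simp only; omega
  vertices := by
    ext v
    constructor
    · intro hv
      obtain ⟨i, j, hb, rfl⟩ := exists_coeff_ne_zero_of_mem_extremePoints hv
      rcases resonantCoeff_ne_zero.1 hb with ⟨rfl, rfl⟩ | ⟨rfl, rfl⟩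
      · exact ⟨1, by simp, by simp⟩
      · exact ⟨2, by simp, by simp⟩
    · rintro ⟨k, hk, rfl⟩
      have hγ' : (0 : ℝ) < γ := by exact_mod_cast hγ
      obtain rfl | rfl : k = 1 ∨ k = 2 := by have := hk.1; have := hk.2; omega
      · refine mem_extremePoints_of_lex_min (α := 1) (β := 0) (α' := 0) (β' := 1) (by norm_num)
          (by norm_num) (by norm_num) (by norm_num) (by norm_num)
          (resonantCoeff_ne_zero.2 (by simp)) fun i j hij => ?_
        rcases resonantCoeff_ne_zero.1 hij with ⟨rfl, rfl⟩ | ⟨rfl, rfl⟩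
        · right; simp
        · left; push_cast; linarith
      · refine mem_extremePoints_of_lex_min (α := 0) (β := 1) (α' := 1) (β' := 0) (by norm_num)
          (by norm_num) (by norm_num) (by norm_num) (by norm_num)
          (resonantCoeff_ne_zero.2 (by simp)) fun i j hij => ?_
        rcases resonantCoeff_ne_zero.1 hij with ⟨rfl, rfl⟩ | ⟨rfl, rfl⟩
        · left; norm_num
        · right; simp

/-- The map `(z ^ 2, z ^ γ w + z ^ (2 γ))` leaves no wedge `|z| ^ γ < r ^ γ |w|`, `|w| < r`
invariant. -/
theorem exists_mem_wedge_resonant_notMem {γ : ℕ} (hγ : 1 ≤ γ) {r : ℝ} (hr : 0 < r) :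
    ∃ x ∈ wedge 0 (γ : ℝ)⁻¹ r, x.1 ≠ 0 ∧
      skewProduct (fun z => z ^ 2) (fun x => x.1 ^ γ * x.2 + x.1 ^ (2 * γ)) x ∉
        wedge 0 (γ : ℝ)⁻¹ r := by
  have hγ0 : γ ≠ 0 := by omega
  have hγ' : (0 : ℝ) < (γ : ℝ)⁻¹ := by positivity
  set ρ := r ^ γ with hρ
  have hρ0 : 0 < ρ := by positivity
  have hroot : ∀ t : ℝ, 0 ≤ t → (t ^ γ) ^ (γ : ℝ)⁻¹ = t := fun t ht =>
    Real.pow_rpow_inv_natCast ht hγ0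
  have hρr : ρ ^ (γ : ℝ)⁻¹ = r := hroot r hr.le
  -- The witness is `w = -z^γ (1 + ρ⁻¹)`: the two terms nearly cancel, and the second component of
  -- the image is `-ρ⁻¹ z^(2γ)`. The image lies exactly on the boundary `|z|^γ = ρ |w|` of the
  -- wedge. Taking `z` small ensures `|w| < r`.
  obtain ⟨z, hz0, hz⟩ : ∃ z : ℝ, 0 < z ∧ z ^ γ * (1 + ρ⁻¹) < r := by
    have hc : Filter.Tendsto (fun z : ℝ => z ^ γ * (1 + ρ⁻¹)) (nhdsWithin 0 (Ioi 0))
        (nhds ((0 : ℝ) ^ γ * (1 + ρ⁻¹))) :=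
      ((by fun_prop : Continuous fun z : ℝ => z ^ γ * (1 + ρ⁻¹)).tendsto 0).mono_left
        nhdsWithin_le_nhds
    rw [zero_pow hγ0, zero_mul] at hc
    obtain ⟨z, h1, h2⟩ := ((hc.eventually (gt_mem_nhds hr)).and self_mem_nhdsWithin).exists
    exact ⟨z, h2, h1⟩
  have hnz : ‖(z : ℂ)‖ = z := by simp [abs_of_pos hz0]
  have hpos : 0 < z ^ γ * (1 + ρ⁻¹) := by positivity
  have hnw : ‖(-(z ^ γ * (1 + ρ⁻¹) : ℝ) : ℂ)‖ = z ^ γ * (1 + ρ⁻¹) := by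
    rw [norm_neg, Complex.norm_real, Real.norm_of_nonneg hpos.le]
  refine ⟨((z : ℂ), (-(z ^ γ * (1 + ρ⁻¹) : ℝ) : ℂ)), ⟨?_, ?_⟩, ?_, ?_⟩
  · simp only [zero_mul, zero_add, Real.rpow_one]
    rw [hnz, hnw]
    calc z = r * (z ^ γ * ρ⁻¹) ^ (γ : ℝ)⁻¹ := by
          rw [Real.mul_rpow (by positivity) (by positivity), hroot z hz0.le,
            Real.inv_rpow hρ0.le, hρr]
          field_simp
      _ < _ := by
          refine mul_lt_mul_of_pos_left (Real.rpow_lt_rpow (by positivity) ?_ hγ') hr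
          have : 0 < z ^ γ := by positivity
          linarith
  · simp only [Real.rpow_zero, mul_one]
    rw [hnw]; exact hz
  · simpa using hz0.ne'
  · rintro ⟨h, -⟩
    have e : (z : ℂ) ^ γ * (-(z ^ γ * (1 + ρ⁻¹) : ℝ) : ℂ) + (z : ℂ) ^ (2 * γ) =
        -(((z ^ 2) ^ γ * ρ⁻¹ : ℝ) : ℂ) := by
      push_cast
      ring
    simp only [skewProduct, zero_mul, zero_add, Real.rpow_one] at h
    rw [e, norm_neg, Complex.norm_real, Real.norm_of_nonneg (by positivity), norm_pow, hnz,
      Real.mul_rpow (by positivity) (by positivity), hroot _ (by positivity),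
      Real.inv_rpow hρ0.le, hρr] at h
    field_simp at h
    exact lt_irrefl _ h

/-- The obstruction does not involve `φ`: invariance of the wedge fails at a point with `z ≠ 0`,
where the exemption for the line `z = 0` does not apply. -/
theorem exists_resonant_not_isBottcherOn (γ : ℕ) (hγ : 1 ≤ γ) :
    ∃ (a : ℕ → ℂ) (b : ℕ → ℕ → ℂ) (s : ℕ) (n m : ℕ → ℕ) (l₁ κ : ℝ),
      IsSuperattractingSkewProduct (fun z => z ^ 2)
        (fun x => x.1 ^ γ * x.2 + x.1 ^ (2 * γ)) a b 2 ∧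
      IsVertexList b s n m ∧
      IsDominantData 2 s n m γ 1 l₁ κ ∧
      1 < s ∧ intercept n m 1 = 2 ∧
      ∀ r > 0, ¬ ∃ φ : ℂ × ℂ → ℂ × ℂ,
        IsBottcherOn (skewProduct (fun z => z ^ 2) (fun x => x.1 ^ γ * x.2 + x.1 ^ (2 * γ)))
          (monomialMap (a 2) (b γ 1) 2 γ 1) (wedge l₁ κ r) φ := by
  have hγ' : (γ : ℝ) ≠ 0 := by positivity
  have hT : intercept (fun k => k * γ) (fun k => 2 - k) 1 = 2 := by
    simp only [intercept]
    push_cast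
    norm_num
    field_simp
    ring
  refine ⟨_, _, 2, _, _, 0, (γ : ℝ)⁻¹, isSuperattractingSkewProduct_resonant hγ,
    isVertexList_resonant hγ, Or.inr (Or.inr (Or.inl ⟨one_lt_two, ?_, by simp, rfl, rfl, ?_⟩)),
    one_lt_two, hT, ?_⟩
  · rw [hT]; norm_num
  · congr 1
    simp only [weight]
    push_cast
    norm_num
    ring
  · rintro r hr ⟨φ, hφ⟩
    obtain ⟨x, hx, hx0, hfx⟩ := exists_mem_wedge_resonant_notMem hγ hr
    rcases hφ.invariant x hx with h | h
    · exact hfx h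
    · exact hx0 h.1

end BottcherSkew

/-! ### Geometry of the wedge and dominance of `z^γ w` on it. -/

namespace BottcherSkew

open Set Filter Topology Metric

section Wedge

variable {l₁ κ r : ℝ} {x : ℂ × ℂ}

theorem wedge_mono {r' : ℝ} (h : r ≤ r') : wedge l₁ κ r ⊆ wedge l₁ κ r' := fun _ hx =>
  ⟨hx.1.trans_le (mul_le_mul_of_nonneg_right h (by positivity)),
    hx.2.trans_le (mul_le_mul_of_nonneg_right h (by positivity))⟩

theorem isOpen_wedge (hl : 0 ≤ l₁) (hκ : 0 ≤ κ) : IsOpen (wedge l₁ κ r) := by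
  have h1 : ∀ {e : ℝ}, 0 ≤ e → ∀ {g : ℂ × ℂ → ℂ}, Continuous g →
      Continuous fun x => ‖g x‖ ^ e := fun he g hg =>
    hg.norm.rpow_const fun _ => Or.inr he
  exact (isOpen_lt (h1 (by positivity) continuous_fst)
    (continuous_const.mul (h1 hκ continuous_snd))).inter
    (isOpen_lt continuous_snd.norm (continuous_const.mul (h1 hl continuous_fst)))

theorem eq_zero_of_mem_wedge (hx : x ∈ wedge l₁ κ r) (h0 : x.1 = 0) : l₁ = 0 := by
  by_contra hne
  have := hx.2
  rw [h0, norm_zero, Real.zero_rpow hne, mul_zero] at this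
  exact absurd this (not_lt.2 (norm_nonneg _))

theorem snd_ne_zero_of_mem_wedge (hκ : 0 < κ) (hx : x ∈ wedge l₁ κ r) : x.2 ≠ 0 := by
  intro h0
  have := hx.1
  rw [h0, norm_zero, Real.zero_rpow hκ.ne', mul_zero] at this
  exact absurd this (not_lt.2 (by positivity))

/-- Insert the bound on `|w|` into the other inequality of the wedge and cancel `|z|^(l₁κ)`. -/
theorem norm_fst_lt_of_mem_wedge (hκ : 0 ≤ κ) (hr : 0 < r) (hr1 : r ≤ 1)
    (hx : x ∈ wedge l₁ κ r) : ‖x.1‖ < r := by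
  rcases eq_or_ne x.1 0 with h0 | h0
  · simpa [h0] using hr
  have hZ : 0 < ‖x.1‖ := norm_pos_iff.2 h0
  have h1 : ‖x.2‖ ^ κ ≤ (r * ‖x.1‖ ^ l₁) ^ κ := Real.rpow_le_rpow (norm_nonneg _) hx.2.le hκ
  have h2 : (r * ‖x.1‖ ^ l₁) ^ κ ≤ ‖x.1‖ ^ (l₁ * κ) := by
    rw [Real.mul_rpow hr.le (by positivity), ← Real.rpow_mul hZ.le]
    exact mul_le_of_le_one_left (by positivity) (Real.rpow_le_one hr.le hr1 hκ)
  have h3 : ‖x.1‖ ^ (l₁ * κ) * ‖x.1‖ < ‖x.1‖ ^ (l₁ * κ) * r := by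
    rw [← Real.rpow_add_one hZ.ne', mul_comm _ r]
    exact hx.1.trans_le (mul_le_mul_of_nonneg_left (h1.trans h2) hr.le)
  exact lt_of_mul_lt_mul_left h3 (by positivity)

theorem norm_snd_lt_of_mem_wedge (hl : 0 ≤ l₁) (hκ : 0 ≤ κ) (hr : 0 < r) (hr1 : r ≤ 1)
    (hx : x ∈ wedge l₁ κ r) : ‖x.2‖ < r := by
  refine hx.2.trans_le (mul_le_of_le_one_right hr.le (Real.rpow_le_one (norm_nonneg _) ?_ hl))
  exact ((norm_fst_lt_of_mem_wedge hκ hr hr1 hx).trans_le hr1).le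

/-- On the wedge, `|z ^ k w ^ (j - 1)|` is bounded by a power of `r` for `j ≥ 1`. -/
theorem norm_zpow_mul_zpow_le_of_one_le (hl : 0 ≤ l₁) (hκ : 0 ≤ κ) (hr : 0 < r) (hr1 : r ≤ 1)
    (hx : x ∈ wedge l₁ κ r) {k : ℤ} {j : ℕ} (hj : 1 ≤ j) (hk : 0 ≤ (k : ℝ) + l₁ * ((j : ℝ) - 1)) :
    ‖x.1 ^ k * x.2 ^ ((j : ℤ) - 1)‖ ≤ r ^ ((k : ℝ) + (1 + l₁) * ((j : ℝ) - 1)) := by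
  obtain ⟨j, rfl⟩ : ∃ i, j = i + 1 := ⟨j - 1, by omega⟩
  have e : (((j + 1 : ℕ) : ℤ) - 1) = (j : ℤ) := by push_cast; ring
  have e' : (((j + 1 : ℕ) : ℝ) - 1) = (j : ℝ) := by push_cast; ring
  rw [e, zpow_natCast, norm_mul, norm_zpow, norm_pow]
  rw [e'] at hk ⊢
  have hZr := norm_fst_lt_of_mem_wedge hκ hr hr1 hx
  rcases eq_or_ne x.1 0 with h0 | h0
  · obtain rfl := eq_zero_of_mem_wedge hx h0
    have hW := norm_snd_lt_of_mem_wedge hl hκ hr hr1 hx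
    rcases eq_or_ne k 0 with rfl | hk0
    · simpa [Real.rpow_natCast] using pow_le_pow_left₀ (norm_nonneg _) hW.le j
    · rw [h0, norm_zero, zero_zpow k hk0, zero_mul]
      positivity
  · have hZ : 0 < ‖x.1‖ := norm_pos_iff.2 h0
    calc ‖x.1‖ ^ k * ‖x.2‖ ^ j ≤ ‖x.1‖ ^ k * (r * ‖x.1‖ ^ l₁) ^ j :=
          mul_le_mul_of_nonneg_left (pow_le_pow_left₀ (norm_nonneg _) hx.2.le j) (by positivity)
      _ = r ^ (j : ℝ) * ‖x.1‖ ^ ((k : ℝ) + l₁ * j) := by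
          rw [Real.rpow_add hZ, Real.rpow_mul hZ.le, Real.rpow_intCast, Real.rpow_natCast,
            Real.rpow_natCast, mul_pow]
          ring
      _ ≤ r ^ (j : ℝ) * r ^ ((k : ℝ) + l₁ * j) :=
          mul_le_mul_of_nonneg_left (Real.rpow_le_rpow hZ.le hZr.le hk) (by positivity)
      _ = _ := by rw [← Real.rpow_add hr]; congr 1; ring

/-- On the wedge, `|z ^ k w⁻¹|` is bounded by a power of `r`. -/
theorem norm_zpow_mul_inv_le (hl : 0 ≤ l₁) (hκ : 0 < κ) (hr : 0 < r) (hr1 : r ≤ 1)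
    (hx : x ∈ wedge l₁ κ r) {k : ℤ} (hk : l₁ + κ⁻¹ ≤ (k : ℝ)) :
    ‖x.1 ^ k * x.2⁻¹‖ ≤ r ^ ((k : ℝ) - l₁) := by
  have hκi : 0 < κ⁻¹ := inv_pos.2 hκ
  have hZr := norm_fst_lt_of_mem_wedge hκ.le hr hr1 hx
  have hk0 : k ≠ 0 := by
    rintro rfl
    simp only [Int.cast_zero] at hk
    linarith
  rcases eq_or_ne x.1 0 with h0 | h0
  · rw [h0, zero_zpow k hk0, zero_mul, norm_zero]
    positivity
  · have hZ : 0 < ‖x.1‖ := norm_pos_iff.2 h0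
    have hW : 0 < ‖x.2‖ := norm_pos_iff.2 (snd_ne_zero_of_mem_wedge hκ hx)
    -- The first inequality of the wedge raised to the power `1/κ = l₂`.
    have h1 : ‖x.1‖ ^ (l₁ + κ⁻¹) ≤ r ^ κ⁻¹ * ‖x.2‖ := by
      have := Real.rpow_le_rpow (by positivity) hx.1.le hκi.le
      rw [Real.mul_rpow hr.le (by positivity), Real.rpow_rpow_inv hW.le hκ.ne',
        ← Real.rpow_mul hZ.le] at this
      convert this using 2
      field_simp
    rw [norm_mul, norm_zpow, norm_inv, ← div_eq_mul_inv, div_le_iff₀ hW]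
    calc ‖x.1‖ ^ k = ‖x.1‖ ^ ((k : ℝ) - (l₁ + κ⁻¹)) * ‖x.1‖ ^ (l₁ + κ⁻¹) := by
          rw [← Real.rpow_add hZ, sub_add_cancel, Real.rpow_intCast]
      _ ≤ r ^ ((k : ℝ) - (l₁ + κ⁻¹)) * (r ^ κ⁻¹ * ‖x.2‖) :=
          mul_le_mul (Real.rpow_le_rpow hZ.le hZr.le (by linarith)) h1 (by positivity)
            (by positivity)
      _ = _ := by rw [← mul_assoc, ← Real.rpow_add hr]; congr 2; ring

end Wedge

/-- A power series with lowest order term `a δ z ^ δ` equals `a δ z ^ δ (1 + O(z))`. -/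
theorem exists_eq_monomial_mul_one_add {p : ℂ → ℂ} {a : ℕ → ℂ} {δ : ℕ} (hp : HasSeriesAtZero p a)
    (ha : a δ ≠ 0) (ha0 : ∀ i < δ, a i = 0) :
    ∃ (ζ : ℂ → ℂ) (ρ K : ℝ), 0 < ρ ∧ 0 ≤ K ∧ DifferentiableOn ℂ ζ (ball 0 ρ) ∧
      ∀ z ∈ ball (0 : ℂ) ρ, p z = a δ * z ^ δ * (1 + ζ z) ∧ ‖ζ z‖ ≤ K * ‖z‖ := by
  obtain ⟨ρ, hρ, hsum⟩ := hp
  set g : ℂ → ℂ := fun z => ∑' i, a (i + δ) * z ^ i with hg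
  have hshift : ∀ z : ℂ, ‖z‖ < ρ → HasSum (fun i => a (i + δ) * z ^ (i + δ)) (p z) := by
    intro z hz
    have := (hasSum_nat_add_iff' δ).2 (hsum z hz)
    rwa [Finset.sum_eq_zero, sub_zero] at this
    intro i hi
    rw [ha0 i (Finset.mem_range.1 hi), zero_mul]
  have hsummable : ∀ z : ℂ, ‖z‖ < ρ → Summable fun i => a (i + δ) * z ^ i := by
    intro z hz
    rcases eq_or_ne z 0 with rfl | h0
    · refine summable_of_ne_finset_zero (s := {0}) fun i hi => ?_
      rw [zero_pow (by simpa using hi), mul_zero]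
    · refine ((hshift z hz).summable.mul_left (z ^ δ)⁻¹).congr fun i => ?_
      rw [pow_add]; field_simp
  have hgp : ∀ z : ℂ, ‖z‖ < ρ → p z = z ^ δ * g z := by
    intro z hz
    refine (hshift z hz).unique ?_
    exact ((hsummable z hz).hasSum.mul_left (z ^ δ)).congr_fun fun i => by rw [pow_add]; ring
  have hgan : AnalyticAt ℂ g 0 := by
    refine ⟨FormalMultilinearSeries.ofScalars ℂ fun i => a (i + δ), hasFPowerSeriesAt_iff.2 ?_⟩
    filter_upwards [ball_mem_nhds (0 : ℂ) hρ] with z hz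
    rw [zero_add]
    exact (hsummable z (by simpa using hz)).hasSum.congr_fun fun i => by
      simp [FormalMultilinearSeries.coeff_ofScalars, mul_comm]
  have hg0 : g 0 = a δ := by
    rw [hg]
    simp only
    rw [tsum_eq_single 0 fun i hi => by rw [zero_pow hi, mul_zero]]
    simp
  set ζ : ℂ → ℂ := fun z => g z / a δ - 1 with hζ
  have hζan : AnalyticAt ℂ ζ 0 := (hgan.div_const).sub analyticAt_const
  have hζ0 : ζ 0 = 0 := by simp [hζ, hg0, ha]
  obtain ⟨K, hK⟩ := hζan.differentiableAt.isBigO_sub.bound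
  obtain ⟨ρ', hρ', hsub⟩ := Metric.mem_nhds_iff.1
    (inter_mem (inter_mem hζan.eventually_analyticAt hK) (ball_mem_nhds 0 hρ))
  refine ⟨ζ, ρ', max K 0, hρ', le_max_right _ _, fun z hz =>
    (hsub hz).1.1.differentiableAt.differentiableWithinAt, fun z hz => ⟨?_, ?_⟩⟩
  · rw [hgp z (by simpa using (hsub hz).2), hζ]
    field_simp
    ring
  · have h1 : ‖ζ z - ζ 0‖ ≤ K * ‖z - 0‖ := (hsub hz).1.2
    rw [hζ0, sub_zero, sub_zero] at h1
    exact h1.trans (mul_le_mul_of_nonneg_right (le_max_left _ _) (norm_nonneg _))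

/-- On a small wedge, the term `b γ 1 z ^ γ w` dominates `q`. -/
theorem IsAdmissible.exists_eq_dominant_mul_one_add {q : ℂ × ℂ → ℂ} {b : ℕ → ℕ → ℂ} {δ γ : ℕ}
    {l₁ κ : ℝ} (h : IsAdmissible b δ γ l₁ κ) (hq : HasDoubleSeriesAtZero q b) :
    ∃ (η : ℂ × ℂ → ℂ) (R K c : ℝ), 0 < R ∧ R ≤ 1 ∧ 0 ≤ K ∧ 0 < c ∧ c ≤ 1 ∧ η 0 = 0 ∧
      DifferentiableOn ℂ η (wedge l₁ κ R) ∧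
      (∀ x ∈ wedge l₁ κ R, q x = b γ 1 * x.1 ^ γ * x.2 * (1 + η x)) ∧
      ∀ r, 0 < r → r ≤ R → ∀ x ∈ wedge l₁ κ r, ‖η x‖ ≤ K * r ^ c := by
  obtain ⟨ρ, hρ, hsum⟩ := hq
  obtain ⟨R, hR0, hRρ, hR1⟩ : ∃ R, 0 < R ∧ R < ρ ∧ R ≤ 1 :=
    ⟨min (ρ / 2) 1, by positivity, (min_le_left _ _).trans_lt (by linarith), min_le_right _ _⟩
  -- Relative to `z^γ w`, pure powers of `z` gain at least `r^(1/κ)` and all other terms at least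
  -- `r`.
  obtain ⟨c, hc0, hc1, hcκ⟩ : ∃ c : ℝ, 0 < c ∧ c ≤ 1 ∧ (0 < κ → c ≤ κ⁻¹) := by
    by_cases hκ : 0 < κ
    · exact ⟨min 1 κ⁻¹, lt_min one_pos (inv_pos.2 hκ), min_le_left _ _, fun _ => min_le_right _ _⟩
    · exact ⟨1, one_pos, le_rfl, fun h => absurd h hκ⟩
  have hl := h.l₁_nonneg
  have hκ := h.κ_nonneg
  set β := b γ 1 with hβ
  have hβ0 : β ≠ 0 := h.coeff_ne_zero
  -- The terms of `q` divided by `β z^γ w`, without the dominant one, so that `η = ∑ T`.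
  set T : ℕ × ℕ → ℂ × ℂ → ℂ := fun ij x => if ij = (γ, 1) then 0 else
    b ij.1 ij.2 / β * (x.1 ^ ((ij.1 : ℤ) - γ) * x.2 ^ ((ij.2 : ℤ) - 1)) with hT
  set M := R ^ (-(1 + γ + l₁)) with hM
  have hM0 : 0 < M := by positivity
  have hbound : ∀ r, 0 < r → r ≤ R → ∀ x ∈ wedge l₁ κ r, ∀ ij,
      ‖T ij x‖ ≤ ‖b ij.1 ij.2‖ * R ^ (ij.1 + ij.2) * (M / ‖β‖ * (r / R) ^ c) := by
    rintro r hr hrR x hx ⟨i, j⟩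
    have hr1 := hrR.trans hR1
    by_cases hij : (i, j) = (γ, 1)
    · simp only [hT, if_pos hij, norm_zero]; positivity
    by_cases hb : b i j = 0
    · simp [hT, hb]
    simp only [hT, if_neg hij, norm_mul, norm_div]
    rw [← norm_mul]
    -- The two lower bounds on `E` play different roles: `c ≤ E` gives the decay in `r`, while the
    -- other bounds the terms by `|b i j| R^(i+j)` up to a constant, which is summable.
    obtain ⟨E, hcE, hE, hle⟩ : ∃ E : ℝ, c ≤ E ∧ (i : ℝ) + j - (1 + γ + l₁) ≤ E ∧
        ‖x.1 ^ ((i : ℤ) - γ) * x.2 ^ ((j : ℤ) - 1)‖ ≤ r ^ E := by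
      rcases Nat.eq_zero_or_pos j with rfl | hj
      · obtain ⟨hκ0, hi⟩ := h.le_of_eq_zero i hb
        have h1 := norm_zpow_mul_inv_le hl hκ0 hr hr1 hx (k := (i : ℤ) - γ)
          (by push_cast; linarith)
        refine ⟨(i : ℝ) - γ - l₁, ?_, ?_, ?_⟩
        · have := hcκ hκ0; linarith
        · push_cast; linarith
        · simpa using h1
      · have hi := h.le_of_one_le i j hb hj
        have h1 := norm_zpow_mul_zpow_le_of_one_le hl hκ hr hr1 hx hj (k := (i : ℤ) - γ)
          (by push_cast; linarith)
        have hj' : (1 : ℝ) ≤ j := by exact_mod_cast hj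
        have hlj := mul_nonneg hl (sub_nonneg.2 hj')
        refine ⟨(i : ℝ) - γ + (1 + l₁) * ((j : ℝ) - 1), ?_, ?_, ?_⟩
        · rcases (show 1 ≤ j from hj).eq_or_lt with rfl | hj2
          · have hne : i ≠ γ := fun e => hij (by rw [e])
            have : γ ≤ i := by
              simp only [Nat.cast_one, sub_self, mul_zero, add_zero, Nat.cast_le] at hi
              exact hi
            have : (γ : ℝ) + 1 ≤ i := by exact_mod_cast lt_of_le_of_ne this hne.symm
            push_cast
            linarith
          · have : (2 : ℝ) ≤ j := by exact_mod_cast hj2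
            linarith
        · linarith
        · simpa using h1
    have hrR1 : r / R ≤ 1 := (div_le_one hR0).2 hrR
    have hrR0 : 0 < r / R := by positivity
    have h2 : r ^ E ≤ R ^ (i + j) * M * (r / R) ^ c := by
      calc r ^ E = R ^ E * (r / R) ^ E := by
            rw [← Real.mul_rpow hR0.le hrR0.le, mul_div_cancel₀ _ hR0.ne']
        _ ≤ R ^ ((i : ℝ) + j - (1 + γ + l₁)) * (r / R) ^ c :=
            mul_le_mul (Real.rpow_le_rpow_of_exponent_ge hR0 hR1 hE)
              (Real.rpow_le_rpow_of_exponent_ge hrR0 hrR1 hcE) (by positivity) (by positivity)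
        _ = _ := by
            rw [sub_eq_add_neg, Real.rpow_add hR0, ← Nat.cast_add, Real.rpow_natCast]
    calc ‖b i j‖ / ‖β‖ * ‖x.1 ^ ((i : ℤ) - γ) * x.2 ^ ((j : ℤ) - 1)‖
        ≤ ‖b i j‖ / ‖β‖ * (R ^ (i + j) * M * (r / R) ^ c) :=
          mul_le_mul_of_nonneg_left (hle.trans h2) (by positivity)
      _ = _ := by ring
  have hbsum : Summable fun ij : ℕ × ℕ => ‖b ij.1 ij.2‖ * R ^ (ij.1 + ij.2) := by
    have hRn : ‖(R : ℂ)‖ < ρ := by rwa [Complex.norm_real, Real.norm_of_nonneg hR0.le]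
    refine (hsum R R hRn hRn).summable.norm.congr fun ij => ?_
    rw [norm_mul, norm_mul, norm_pow, norm_pow, Complex.norm_real, Real.norm_of_nonneg hR0.le,
      pow_add, mul_assoc]
  have hTsum : ∀ x ∈ wedge l₁ κ R, Summable fun ij => T ij x := fun x hx =>
    Summable.of_norm_bounded (hbsum.mul_right _) fun ij => hbound R hR0 le_rfl x hx ij
  refine ⟨fun x => ∑' ij, T ij x, R,
    (∑' ij : ℕ × ℕ, ‖b ij.1 ij.2‖ * R ^ (ij.1 + ij.2)) * (M / ‖β‖ * (R⁻¹) ^ c), c, hR0, hR1,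
    by positivity, hc0, hc1, ?_, ?_, ?_, ?_⟩
  · have : ∀ ij, T ij 0 = 0 := by
      rintro ⟨i, j⟩
      by_cases hij : (i, j) = (γ, 1)
      · simp only [hT, if_pos hij]
      simp only [hT, if_neg hij, Prod.fst_zero, Prod.snd_zero]
      by_cases hi : (i : ℤ) - γ = 0
      · have hj : (j : ℤ) - 1 ≠ 0 := fun hj => hij (by ext <;> simp <;> omega)
        rw [zero_zpow _ hj, mul_zero, mul_zero]
      · rw [zero_zpow _ hi, zero_mul, mul_zero]
    simp [this]
  · refine differentiableOn_tsum_of_norm_le (hbsum.mul_right _) (isOpen_wedge hl hκ) ?_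
      fun ij x hx => hbound R hR0 le_rfl x hx ij
    rintro ⟨i, j⟩ x hx
    refine DifferentiableAt.differentiableWithinAt ?_
    by_cases hij : (i, j) = (γ, 1)
    · simp only [hT, if_pos hij]; exact differentiableAt_const _
    by_cases hb : b i j = 0
    · simp only [hT, if_neg hij, hb, zero_div, zero_mul]; exact differentiableAt_const _
    simp only [hT, if_neg hij]
    refine (DifferentiableAt.mul (differentiableAt_fst.zpow ?_)
      (differentiableAt_snd.zpow ?_)).const_mul _
    -- The wedge meets `z = 0` only if `l₁ = 0`, and then `γ ≤ i` for every term, so no negative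
    -- power of `z` occurs.
    · by_cases h0 : x.1 = 0
      · right
        have hl0 := eq_zero_of_mem_wedge hx h0
        rw [sub_nonneg, Nat.cast_le]
        rcases Nat.eq_zero_or_pos j with rfl | hj
        · obtain ⟨hκ0, hi⟩ := h.le_of_eq_zero i hb
          have := inv_pos.2 hκ0
          have : (γ : ℝ) ≤ i := by linarith
          exact_mod_cast this
        · have := h.le_of_one_le i j hb hj
          rw [hl0, zero_mul, add_zero] at this
          exact_mod_cast this
      · exact Or.inl h0
    · rcases Nat.eq_zero_or_pos j with rfl | hj
      · exact Or.inl (snd_ne_zero_of_mem_wedge (h.le_of_eq_zero i hb).1 hx)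
      · right; omega
  · intro x hx
    have hxz := (norm_fst_lt_of_mem_wedge hκ hR0 hR1 hx).trans hRρ
    have hxw := (norm_snd_lt_of_mem_wedge hl hκ hR0 hR1 hx).trans hRρ
    have h1 : HasSum (fun ij : ℕ × ℕ => if ij = (γ, 1) then (1 : ℂ) else 0) 1 := by
      simpa using hasSum_ite_eq ((γ, 1) : ℕ × ℕ) (1 : ℂ)
    have h2 := (h1.add (hTsum x hx).hasSum).mul_left (β * x.1 ^ γ * x.2)
    refine (hsum x.1 x.2 hxz hxw).unique (h2.congr_fun ?_)
    rintro ⟨i, j⟩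
    by_cases hij : (i, j) = (γ, 1)
    · obtain ⟨rfl, rfl⟩ := Prod.mk.inj hij
      simp [hT, hβ]
    by_cases hb : b i j = 0
    · simp [hT, hij, hb]
    simp only [hT, if_neg hij, zero_add]
    have e1 : x.1 ^ γ * x.1 ^ ((i : ℤ) - γ) = x.1 ^ i := by
      by_cases hi : γ ≤ i
      · rw [← Nat.cast_sub hi, zpow_natCast, ← pow_add, Nat.add_sub_cancel' hi]
      · have h0 : x.1 ≠ 0 := by
          intro h0
          have hl0 := eq_zero_of_mem_wedge hx h0
          refine hi ?_
          rcases Nat.eq_zero_or_pos j with rfl | hj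
          · obtain ⟨hκ0, hi⟩ := h.le_of_eq_zero i hb
            have := inv_pos.2 hκ0
            have : (γ : ℝ) ≤ i := by linarith
            exact_mod_cast this
          · have := h.le_of_one_le i j hb hj
            rw [hl0, zero_mul, add_zero] at this
            exact_mod_cast this
        rw [← zpow_natCast x.1 γ, ← zpow_add₀ h0, add_sub_cancel, zpow_natCast]
    have e2 : x.2 * x.2 ^ ((j : ℤ) - 1) = x.2 ^ j := by
      rcases Nat.eq_zero_or_pos j with rfl | hj
      · have := snd_ne_zero_of_mem_wedge (h.le_of_eq_zero i hb).1 hx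
        simp [this]
      · rw [show (j : ℤ) - 1 = ((j - 1 : ℕ) : ℤ) by omega, zpow_natCast, ← pow_succ',
          Nat.sub_add_cancel hj]
    rw [← e1, ← e2]
    field_simp
  · intro r hr hrR x hx
    have hs := hbsum.mul_right (M / ‖β‖ * (r / R) ^ c)
    have hn : Summable fun ij => ‖T ij x‖ :=
      Summable.of_nonneg_of_le (fun _ => norm_nonneg _) (hbound r hr hrR x hx) hs
    calc ‖∑' ij, T ij x‖ ≤ ∑' ij, ‖T ij x‖ := norm_tsum_le_tsum_norm hn
      _ ≤ _ := hn.tsum_le_tsum (hbound r hr hrR x hx) hs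
      _ = _ := by
          rw [tsum_mul_right, div_eq_mul_inv r R, Real.mul_rpow hr.le (by positivity)]
          ring

end BottcherSkew

/-! ### Normal form and attraction to the origin. -/

namespace BottcherSkew

open Set Filter Topology Metric

/-- A skew product in the form `(α z ^ δ (1 + ζ), β z ^ γ w (1 + η))` on the wedge of radius `R`,
with `ζ` and `η` small, together with a quantitative form of the attraction to the origin. -/
structure IsNormalForm (p : ℂ → ℂ) (q : ℂ × ℂ → ℂ) (α β : ℂ) (δ γ : ℕ) (l₁ κ : ℝ)
    (ζ : ℂ → ℂ) (η : ℂ × ℂ → ℂ) (R K c C e : ℝ) : Prop where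
  two_le : 2 ≤ δ
  one_le : 1 ≤ γ
  l₁_nonneg : 0 ≤ l₁
  κ_nonneg : 0 ≤ κ
  R_pos : 0 < R
  R_le : R ≤ 1
  K_nonneg : 0 ≤ K
  c_pos : 0 < c
  c_le : c ≤ 1
  C_pos : 0 < C
  e_pos : 0 < e
  α_ne_zero : α ≠ 0
  ζ_diff : DifferentiableOn ℂ ζ (ball 0 R)
  p_eq : ∀ z ∈ ball (0 : ℂ) R, p z = α * z ^ δ * (1 + ζ z)
  ζ_le : ∀ z ∈ ball (0 : ℂ) R, ‖ζ z‖ ≤ K * ‖z‖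
  ζ_half : ∀ z ∈ ball (0 : ℂ) R, ‖ζ z‖ ≤ 1 / 2
  p_le : ∀ z ∈ ball (0 : ℂ) R, ‖p z‖ ≤ ‖z‖
  η_diff : DifferentiableOn ℂ η (wedge l₁ κ R)
  q_eq : ∀ x ∈ wedge l₁ κ R, q x = β * x.1 ^ γ * x.2 * (1 + η x)
  η_le : ∀ r, 0 < r → r ≤ R → ∀ x ∈ wedge l₁ κ r, ‖η x‖ ≤ K * r ^ c
  η_half : ∀ x ∈ wedge l₁ κ R, ‖η x‖ ≤ 1 / 2
  η_zero : η 0 = 0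
  q_zero : q 0 = 0
  C_half : C * R ^ e ≤ 1 / 2
  attract : ∀ r, 0 < r → r ≤ R → ∀ x ∈ wedge l₁ κ r, x.1 ≠ 0 →
    skewProduct p q x ∈ wedge l₁ κ (r * (C * ‖x.1‖ ^ e))

/-- If `|P|` and `|Q|` are comparable to `|z| ^ δ` and `|z| ^ γ |w|`, then `(z, w) ↦ (P, Q)`
contracts the wedges. -/
theorem mem_wedge_of_comparable {δ γ : ℕ} {l₁ κ : ℝ} (hl : 0 ≤ l₁) (hκ : 0 ≤ κ)
    {A B e r : ℝ} (hA : 0 < A) (hB : 0 < B) (hr : 0 < r)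
    (he₁ : e ≤ γ - l₁ * ((δ : ℝ) - 1))
    (he₂ : e ≤ ((δ : ℝ) - 1) * (l₁ * κ + 1) - γ * κ) {x y : ℂ × ℂ} (hx : x ∈ wedge l₁ κ r)
    (hx0 : x.1 ≠ 0) (hx1 : ‖x.1‖ ≤ 1)
    (hP₁ : A / 2 * ‖x.1‖ ^ δ ≤ ‖y.1‖) (hP₂ : ‖y.1‖ ≤ 2 * A * ‖x.1‖ ^ δ)
    (hQ₁ : B / 2 * (‖x.1‖ ^ γ * ‖x.2‖) ≤ ‖y.2‖) (hQ₂ : ‖y.2‖ ≤ 2 * B * (‖x.1‖ ^ γ * ‖x.2‖)) :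
    y ∈ wedge l₁ κ (r * ((2 * B * (A / 2) ^ (-l₁) +
      (2 * A) ^ (l₁ * κ + 1) * (B / 2) ^ (-κ)) * ‖x.1‖ ^ e)) := by
  have hZ : 0 < ‖x.1‖ := norm_pos_iff.2 hx0
  set Z := ‖x.1‖ with hZdef
  set W := ‖x.2‖ with hWdef
  have hW0 : 0 ≤ W := norm_nonneg _
  set μ := l₁ * κ + 1 with hμ
  have hμ0 : 0 < μ := by positivity
  -- `C₁` serves the upper bound for the new `|w|`, `C₂` that for the new `|z|`. Their sum works for
  -- both.
  set C₁ := 2 * B * (A / 2) ^ (-l₁) with hC₁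
  set C₂ := (2 * A) ^ μ * (B / 2) ^ (-κ) with hC₂
  have hC₁0 : 0 < C₁ := by positivity
  have hC₂0 : 0 < C₂ := by positivity
  obtain ⟨h1, h2⟩ := hx
  rw [← hZdef, ← hWdef] at h1 h2
  have hpow : ∀ {s t : ℝ}, s ≤ t → Z ^ t ≤ Z ^ s := fun hst =>
    Real.rpow_le_rpow_of_exponent_ge hZ hx1 hst
  constructor
  · calc ‖y.1‖ ^ (l₁ * κ + 1) ≤ (2 * A * Z ^ δ) ^ μ :=
          Real.rpow_le_rpow (norm_nonneg _) hP₂ hμ0.le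
      _ = (2 * A) ^ μ * (Z ^ (((δ : ℝ) - 1) * μ) * Z ^ μ) := by
          rw [Real.mul_rpow (by positivity) (by positivity), ← Real.rpow_natCast Z δ,
            ← Real.rpow_mul hZ.le, ← Real.rpow_add hZ]
          congr 2; ring
      _ < (2 * A) ^ μ * (Z ^ (((δ : ℝ) - 1) * μ) * (r * W ^ κ)) := by
          gcongr
      -- By `he₂`, the exponent `(δ - 1)μ` exceeds the `γκ` needed for the new `|w|^κ` by at least
      -- `e`.
      _ ≤ (2 * A) ^ μ * (Z ^ (e + γ * κ) * (r * W ^ κ)) := by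
          have := hpow (show e + γ * κ ≤ ((δ : ℝ) - 1) * μ by linarith)
          gcongr
      _ = r * (C₂ * Z ^ e) * ((B / 2) ^ κ * (Z ^ (γ * κ) * W ^ κ)) := by
          rw [Real.rpow_add hZ, hC₂, Real.rpow_neg (by positivity)]
          have : (B / 2) ^ κ ≠ 0 := by positivity
          field_simp
      _ = r * (C₂ * Z ^ e) * (B / 2 * (Z ^ γ * W)) ^ κ := by
          rw [Real.mul_rpow (by positivity) (by positivity),
            Real.mul_rpow (by positivity) (by positivity), Real.rpow_mul hZ.le, Real.rpow_natCast]
      _ ≤ r * ((C₁ + C₂) * Z ^ e) * ‖y.2‖ ^ κ := by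
          gcongr
          linarith
  · have hZγ : 0 < Z ^ γ := by positivity
    calc ‖y.2‖ ≤ 2 * B * (Z ^ γ * W) := hQ₂
      _ < 2 * B * (Z ^ γ * (r * Z ^ l₁)) := by gcongr
      _ = r * (2 * B) * Z ^ ((γ : ℝ) + l₁) := by
          rw [Real.rpow_add hZ, Real.rpow_natCast]; ring
      -- By `he₁`, `γ + l₁` exceeds the `δ l₁` needed for the new `|z|^l₁` by at least `e`.
      _ ≤ r * (2 * B) * Z ^ (e + δ * l₁) := by
          have := hpow (show e + δ * l₁ ≤ (γ : ℝ) + l₁ by linarith)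
          gcongr
      _ = r * (C₁ * Z ^ e) * ((A / 2) ^ l₁ * Z ^ (δ * l₁)) := by
          rw [Real.rpow_add hZ, hC₁, Real.rpow_neg (by positivity)]
          have : (A / 2) ^ l₁ ≠ 0 := by positivity
          field_simp
      _ = r * (C₁ * Z ^ e) * (A / 2 * Z ^ δ) ^ l₁ := by
          rw [Real.mul_rpow (by positivity) (by positivity), Real.rpow_mul hZ.le, Real.rpow_natCast]
      _ ≤ r * ((C₁ + C₂) * Z ^ e) * ‖y.1‖ ^ l₁ := by
          gcongr
          linarith

theorem half_le_norm_one_add {u : ℂ} (hu : ‖u‖ ≤ 1 / 2) : 1 / 2 ≤ ‖1 + u‖ := by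
  have := norm_sub_le_norm_add 1 u
  rw [norm_one] at this
  linarith

theorem norm_one_add_le_two {u : ℂ} (hu : ‖u‖ ≤ 1 / 2) : ‖1 + u‖ ≤ 2 := by
  have := norm_add_le 1 u
  rw [norm_one] at this
  linarith

theorem IsAdmissible.exists_isNormalForm {p : ℂ → ℂ} {q : ℂ × ℂ → ℂ} {a : ℕ → ℂ}
    {b : ℕ → ℕ → ℂ} {δ γ : ℕ} {l₁ κ : ℝ} (h : IsAdmissible b δ γ l₁ κ)
    (hf : IsSuperattractingSkewProduct p q a b δ) :
    ∃ (ζ : ℂ → ℂ) (η : ℂ × ℂ → ℂ) (R K c C e : ℝ),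
      IsNormalForm p q (a δ) (b γ 1) δ γ l₁ κ ζ η R K c C e := by
  obtain ⟨ζ, ρ, K₁, hρ, hK₁, hζd, hζ⟩ :=
    exists_eq_monomial_mul_one_add hf.series_fst hf.coeff_ne_zero hf.coeff_eq_zero
  obtain ⟨η, R₁, K₂, c, hR₁, hR₁1, hK₂, hc0, hc1, hη0, hηd, hq, hη⟩ :=
    h.exists_eq_dominant_mul_one_add hf.series_snd
  have hq0 : q 0 = 0 := by
    obtain ⟨ρ', hρ', hsum⟩ := hf.series_snd
    refine (hsum 0 0 (by simpa using hρ') (by simpa using hρ')).unique ?_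
    refine hasSum_zero.congr_fun ?_
    rintro ⟨i, j⟩
    rcases Nat.eq_zero_or_pos i with rfl | hi
    · rcases Nat.eq_zero_or_pos j with rfl | hj
      · simp [hf.fixed]
      · simp [hj.ne']
    · simp [hi.ne']
  have hl := h.l₁_nonneg
  have hκ := h.κ_nonneg
  set A := ‖a δ‖ with hA
  set B := ‖b γ 1‖ with hB
  have hA0 : 0 < A := norm_pos_iff.2 hf.coeff_ne_zero
  have hB0 : 0 < B := norm_pos_iff.2 h.coeff_ne_zero
  -- The smaller gap in the two strict inequalities; its positivity is what `δ ≠ T_k` provides.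
  set e := min ((γ : ℝ) - l₁ * ((δ : ℝ) - 1)) (((δ : ℝ) - 1) * (l₁ * κ + 1) - γ * κ) with he
  have he0 : 0 < e := lt_min (by linarith [h.fst_lt]) (by linarith [h.snd_lt])
  set C := 2 * B * (A / 2) ^ (-l₁) + (2 * A) ^ (l₁ * κ + 1) * (B / 2) ^ (-κ) with hC
  have hC0 : 0 < C := by positivity
  set K := max K₁ K₂ with hK
  have hK0 : 0 ≤ K := hK₁.trans (le_max_left _ _)
  -- `R` is small enough that the relative errors and the contraction factor are at most `1/2`, and,
  -- since `δ ≥ 2`, that `|p z| ≤ |z|`.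
  obtain ⟨R, hR0, hRρ, hRR₁, h1, h2, h3, h4⟩ : ∃ R, 0 < R ∧ R ≤ ρ ∧ R ≤ R₁ ∧ K * R ≤ 1 / 2 ∧
      K * R ^ c ≤ 1 / 2 ∧ C * R ^ e ≤ 1 / 2 ∧ 2 * A * R ≤ 1 := by
    have hlim : ∀ (M t : ℝ), 0 < t → ∀ ε > 0, ∀ᶠ R in 𝓝[>] (0 : ℝ), M * R ^ t ≤ ε := by
      intro M t ht ε hε
      have hc : Continuous fun R : ℝ => M * R ^ t :=
        continuous_const.mul (continuous_id.rpow_const fun _ => Or.inr ht.le)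
      have := hc.tendsto 0
      rw [Real.zero_rpow ht.ne', mul_zero] at this
      exact (this.mono_left nhdsWithin_le_nhds).eventually_le_const hε
    have hlim1 : ∀ (M : ℝ), ∀ ε > 0, ∀ᶠ R in 𝓝[>] (0 : ℝ), M * R ≤ ε := by
      intro M ε hε
      simpa using hlim M 1 one_pos ε hε
    have hall := (hlim1 1 ρ hρ).and <| (hlim1 1 R₁ hR₁).and <| (hlim1 K (1 / 2) (by norm_num)).and <|
      (hlim K c hc0 (1 / 2) (by norm_num)).and <| (hlim C e he0 (1 / 2) (by norm_num)).and <|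
      (hlim1 (2 * A) 1 one_pos).and self_mem_nhdsWithin
    obtain ⟨R, g1, g2, g3, g4, g5, g6, g7⟩ := hall.exists
    exact ⟨R, g7, by linarith, by linarith, g3, g4, g5, g6⟩
  have hR1 : R ≤ 1 := hRR₁.trans hR₁1
  have hball : ball (0 : ℂ) R ⊆ ball 0 ρ := ball_subset_ball hRρ
  have hζle : ∀ z ∈ ball (0 : ℂ) R, ‖ζ z‖ ≤ K * ‖z‖ := fun z hz =>
    (hζ z (hball hz)).2.trans (mul_le_mul_of_nonneg_right (le_max_left _ _) (norm_nonneg _))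
  have hζhalf : ∀ z ∈ ball (0 : ℂ) R, ‖ζ z‖ ≤ 1 / 2 := fun z hz =>
    (hζle z hz).trans <| (mul_le_mul_of_nonneg_left (by simpa using (mem_ball.1 hz).le) hK0).trans h1
  have hηle : ∀ r, 0 < r → r ≤ R → ∀ x ∈ wedge l₁ κ r, ‖η x‖ ≤ K * r ^ c := fun r hr hrR x hx =>
    (hη r hr (hrR.trans hRR₁) x hx).trans
      (mul_le_mul_of_nonneg_right (le_max_right _ _) (by positivity))
  have hηhalf : ∀ x ∈ wedge l₁ κ R, ‖η x‖ ≤ 1 / 2 := fun x hx => (hηle R hR0 le_rfl x hx).trans h2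
  have hpeq : ∀ z ∈ ball (0 : ℂ) R, p z = a δ * z ^ δ * (1 + ζ z) := fun z hz =>
    (hζ z (hball hz)).1
  have hqeq : ∀ x ∈ wedge l₁ κ R, q x = b γ 1 * x.1 ^ γ * x.2 * (1 + η x) := fun x hx =>
    hq x (wedge_mono hRR₁ hx)
  have hPle : ∀ z ∈ ball (0 : ℂ) R, ‖p z‖ ≤ 2 * A * ‖z‖ ^ δ := by
    intro z hz
    rw [hpeq z hz, norm_mul, norm_mul, norm_pow]
    have := mul_le_mul_of_nonneg_left (norm_one_add_le_two (hζhalf z hz))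
      (show 0 ≤ A * ‖z‖ ^ δ by positivity)
    linarith
  refine ⟨ζ, η, R, K, c, C, e, hf.two_le, h.one_le, hl, hκ, hR0, hR1, hK0, hc0, hc1, hC0, he0,
    hf.coeff_ne_zero, hζd.mono hball, hpeq, hζle, hζhalf, ?_,
    hηd.mono (wedge_mono hRR₁), hqeq, hηle, hηhalf, hη0, hq0, h3, ?_⟩
  · intro z hz
    have hzR : ‖z‖ < R := by simpa using hz
    obtain ⟨k, rfl⟩ : ∃ k, δ = k + 2 := ⟨δ - 2, by have := hf.two_le; omega⟩
    calc ‖p z‖ ≤ 2 * A * ‖z‖ ^ (k + 2) := hPle z hz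
      _ = ‖z‖ ^ k * (2 * A * ‖z‖) * ‖z‖ := by ring
      _ ≤ 1 * (2 * A * R) * ‖z‖ := by
          gcongr
          exact pow_le_one₀ (norm_nonneg _) (hzR.le.trans hR1)
      _ ≤ 1 * 1 * ‖z‖ := by gcongr
      _ = ‖z‖ := by ring
  · intro r hr hrR x hx hx0
    have hxr := norm_fst_lt_of_mem_wedge hκ hr (hrR.trans hR1) hx
    have hxR : x.1 ∈ ball (0 : ℂ) R := by simpa using hxr.trans_le hrR
    have hxW := wedge_mono hrR hx
    refine mem_wedge_of_comparable hl hκ hA0 hB0 hr (min_le_left _ _) (min_le_right _ _) hx hx0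
      (hxr.le.trans (hrR.trans hR1)) ?_ (hPle _ hxR) ?_ ?_
    · simp only [skewProduct]
      rw [hpeq _ hxR, norm_mul, norm_mul, norm_pow]
      have := mul_le_mul_of_nonneg_left (half_le_norm_one_add (hζhalf _ hxR))
        (show 0 ≤ A * ‖x.1‖ ^ δ by positivity)
      linarith
    · simp only [skewProduct]
      rw [hqeq _ hxW, norm_mul, norm_mul, norm_mul, norm_pow]
      have := mul_le_mul_of_nonneg_left (half_le_norm_one_add (hηhalf _ hxW))
        (show 0 ≤ B * ‖x.1‖ ^ γ * ‖x.2‖ by positivity)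
      linarith
    · simp only [skewProduct]
      rw [hqeq _ hxW, norm_mul, norm_mul, norm_mul, norm_pow]
      have := mul_le_mul_of_nonneg_left (norm_one_add_le_two (hηhalf _ hxW))
        (show 0 ≤ B * ‖x.1‖ ^ γ * ‖x.2‖ by positivity)
      linarith

namespace IsNormalForm

variable {p : ℂ → ℂ} {q : ℂ × ℂ → ℂ} {α β : ℂ} {δ γ : ℕ} {l₁ κ : ℝ}
    {ζ : ℂ → ℂ} {η : ℂ × ℂ → ℂ} {R K c C e r : ℝ} {x : ℂ × ℂ}
    (h : IsNormalForm p q α β δ γ l₁ κ ζ η R K c C e)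

include h

theorem fst_mem_ball (hx : x ∈ wedge l₁ κ R) : x.1 ∈ ball (0 : ℂ) R := by
  simpa using norm_fst_lt_of_mem_wedge h.κ_nonneg h.R_pos h.R_le hx

theorem p_zero : p 0 = 0 := by
  rw [h.p_eq 0 (by simpa using h.R_pos), zero_pow (by have := h.two_le; omega)]
  simp

theorem map_zero : skewProduct p q 0 = 0 := by
  ext
  · exact h.p_zero
  · exact h.q_zero

theorem map_eq_zero (hx : x ∈ wedge l₁ κ R) (h0 : x.1 = 0) : skewProduct p q x = 0 := by
  ext
  · simpa [skewProduct, h0] using h.p_zero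
  · simp only [skewProduct, Prod.snd_zero]
    rw [h.q_eq x hx, h0, zero_pow (by have := h.one_le; omega)]
    simp

theorem p_ne_zero {z : ℂ} (hz : z ∈ ball (0 : ℂ) R) (h0 : z ≠ 0) : p z ≠ 0 := by
  rw [h.p_eq z hz]
  refine mul_ne_zero (mul_ne_zero h.α_ne_zero (pow_ne_zero _ h0)) fun h1 => ?_
  have := half_le_norm_one_add (h.ζ_half z hz)
  rw [h1, norm_zero] at this
  norm_num at this

theorem map_mem (hr : 0 < r) (hrR : r ≤ R) (hx : x ∈ wedge l₁ κ r) (h0 : x.1 ≠ 0) :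
    skewProduct p q x ∈ wedge l₁ κ (r / 2) ∧ (skewProduct p q x).1 ≠ 0 := by
  refine ⟨wedge_mono ?_ (h.attract r hr hrR x hx h0),
    h.p_ne_zero (h.fst_mem_ball (wedge_mono hrR hx)) h0⟩
  have hZ := norm_fst_lt_of_mem_wedge h.κ_nonneg hr (hrR.trans h.R_le) hx
  have : C * ‖x.1‖ ^ e ≤ 1 / 2 :=
    (mul_le_mul_of_nonneg_left (Real.rpow_le_rpow (norm_nonneg _) (hZ.le.trans hrR) h.e_pos.le)
      h.C_pos.le).trans h.C_half
  have := mul_le_mul_of_nonneg_left this hr.le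
  linarith

theorem iterate_mem (hr : 0 < r) (hrR : r ≤ R) (hx : x ∈ wedge l₁ κ r) (h0 : x.1 ≠ 0) (N : ℕ) :
    (skewProduct p q)^[N] x ∈ wedge l₁ κ (r / 2 ^ N) ∧ ((skewProduct p q)^[N] x).1 ≠ 0 := by
  induction N with
  | zero => simpa using ⟨hx, h0⟩
  | succ N ih =>
    rw [Function.iterate_succ_apply', pow_succ, ← div_div]
    refine h.map_mem (by positivity) ?_ ih.1 ih.2
    exact (div_le_self hr.le (one_le_pow₀ one_le_two)).trans hrR

theorem iterate_eq_zero (hx : x ∈ wedge l₁ κ R) (h0 : x.1 = 0) (N : ℕ) :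
    (skewProduct p q)^[N + 1] x = 0 := by
  rw [Function.iterate_succ_apply, h.map_eq_zero hx h0]
  exact Function.iterate_fixed h.map_zero N

end IsNormalForm

end BottcherSkew

/-! ### Solving the logarithmic conjugacy equations by series along orbits. -/

namespace BottcherSkew

open Set Filter Topology Metric

namespace IsNormalForm

variable {p : ℂ → ℂ} {q : ℂ × ℂ → ℂ} {α β : ℂ} {δ γ : ℕ} {l₁ κ : ℝ}
    {ζ : ℂ → ℂ} {η : ℂ × ℂ → ℂ} {R K c C e : ℝ}
    (h : IsNormalForm p q α β δ γ l₁ κ ζ η R K c C e)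

include h

theorem differentiableOn_p : DifferentiableOn ℂ p (ball 0 R) := by
  refine DifferentiableOn.congr ?_ h.p_eq
  exact ((differentiableOn_id.pow δ).const_mul α).mul (h.ζ_diff.const_add 1)

theorem isOpen_wedge : IsOpen (wedge l₁ κ R) :=
  BottcherSkew.isOpen_wedge h.l₁_nonneg h.κ_nonneg

theorem differentiableOn_skewProduct : DifferentiableOn ℂ (skewProduct p q) (wedge l₁ κ R) := by
  refine DifferentiableOn.prodMk ?_ ?_
  · exact h.differentiableOn_p.comp differentiableOn_fst fun x hx => h.fst_mem_ball hx
  · refine DifferentiableOn.congr ?_ h.q_eq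
    exact (((differentiableOn_fst.pow γ).const_mul β).mul differentiableOn_snd).mul
      (h.η_diff.const_add 1)

/-- The logarithm of the Böttcher coordinate of `p`, divided by the coordinate `z`. -/
theorem exists_log_bottcher : ∃ s : ℂ → ℂ, DifferentiableOn ℂ s (ball 0 R) ∧
    (∀ z ∈ ball (0 : ℂ) R, ‖s z‖ ≤ 2 * K * ‖z‖) ∧
    ∀ z ∈ ball (0 : ℂ) R, δ * s z = Complex.log (1 + ζ z) + s (p z) := by
  have hδ : (2 : ℝ) ≤ δ := by exact_mod_cast h.two_le
  have hδ0 : (δ : ℂ) ≠ 0 := by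
    have := h.two_le
    exact_mod_cast (by omega : δ ≠ 0)
  have hmaps : MapsTo p (ball 0 R) (ball 0 R) := fun z hz => by
    have := h.p_le z hz
    rw [mem_ball_zero_iff] at hz ⊢
    linarith
  have hiter : ∀ (N : ℕ), ∀ z ∈ ball (0 : ℂ) R, p^[N] z ∈ ball (0 : ℂ) R ∧ ‖p^[N] z‖ ≤ ‖z‖ := by
    intro N z hz
    induction N with
    | zero => exact ⟨hz, le_rfl⟩
    | succ N ih =>
      rw [Function.iterate_succ_apply']
      exact ⟨hmaps ih.1, (h.p_le _ ih.1).trans ih.2⟩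
  -- The terms obtained by iterating `s = δ⁻¹ (log(1 + ζ) + s ∘ p)`. They decay like `2^{-(N+1)}`
  -- because `δ ≥ 2` and `|p^N z| ≤ |z|`.
  set t : ℕ → ℂ → ℂ := fun N z => ((δ : ℂ) ^ (N + 1))⁻¹ * Complex.log (1 + ζ (p^[N] z)) with ht
  have hlog : ∀ z ∈ ball (0 : ℂ) R, ‖Complex.log (1 + ζ z)‖ ≤ 3 / 2 * (K * ‖z‖) := fun z hz =>
    (Complex.norm_log_one_add_half_le_self (h.ζ_half z hz)).trans
      (mul_le_mul_of_nonneg_left (h.ζ_le z hz) (by norm_num))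
  have hb : ∀ N, ∀ z ∈ ball (0 : ℂ) R, ‖t N z‖ ≤ 3 / 2 * (K * ‖z‖) * (1 / 2) ^ (N + 1) := by
    intro N z hz
    rw [ht]
    simp only
    rw [norm_mul, norm_inv, norm_pow, Complex.norm_natCast, mul_comm, one_div, inv_pow]
    have hK := h.K_nonneg
    refine mul_le_mul ((hlog _ (hiter N z hz).1).trans ?_) ?_ (by positivity) (by positivity)
    · gcongr
      exact (hiter N z hz).2
    · gcongr
  have hgeo : Summable fun N : ℕ => ((1 : ℝ) / 2) ^ (N + 1) :=
    (summable_nat_add_iff 1).2 summable_geometric_two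
  have hgeo1 : ∑' N : ℕ, ((1 : ℝ) / 2) ^ (N + 1) = 1 := by
    simp only [pow_succ, tsum_mul_right, tsum_geometric_two]
    norm_num
  have hsum : ∀ z ∈ ball (0 : ℂ) R, Summable fun N => t N z := fun z hz =>
    Summable.of_norm_bounded (hgeo.mul_left _) fun N => hb N z hz
  refine ⟨fun z => ∑' N, t N z, ?_, fun z hz => ?_, fun z hz => ?_⟩
  · refine differentiableOn_tsum_of_norm_le
      (u := fun N => 3 / 2 * (K * R) * (1 / 2) ^ (N + 1)) (hgeo.mul_left _) isOpen_ball
      (fun N => ?_) fun N z hz => (hb N z hz).trans ?_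
    · refine DifferentiableOn.const_mul (DifferentiableOn.clog ?_ fun z hz => ?_) _
      · exact (h.ζ_diff.comp (h.differentiableOn_p.iterate hmaps N)
          fun z hz => (hiter N z hz).1).const_add 1
      · exact Complex.mem_slitPlane_of_norm_lt_one
          ((h.ζ_half _ (hiter N z hz).1).trans_lt (by norm_num))
    · have := h.K_nonneg
      have : ‖z‖ ≤ R := by simpa using (mem_ball.1 hz).le
      gcongr
  · have hn : Summable fun N => ‖t N z‖ :=
      Summable.of_nonneg_of_le (fun _ => norm_nonneg _) (fun N => hb N z hz) (hgeo.mul_left _)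
    have := h.K_nonneg
    calc ‖∑' N, t N z‖ ≤ ∑' N, ‖t N z‖ := norm_tsum_le_tsum_norm hn
      _ ≤ ∑' N, 3 / 2 * (K * ‖z‖) * (1 / 2) ^ (N + 1) :=
          hn.tsum_le_tsum (fun N => hb N z hz) (hgeo.mul_left _)
      _ = 3 / 2 * (K * ‖z‖) := by rw [tsum_mul_left, hgeo1, mul_one]
      _ ≤ 2 * K * ‖z‖ := by
          have : 0 ≤ K * ‖z‖ := by positivity
          linarith
  · simp only
    rw [(hsum z hz).tsum_eq_zero_add, mul_add, ← tsum_mul_left]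
    congr 1
    · simp [ht, hδ0]
    · refine tsum_congr fun N => ?_
      simp only [ht, Function.iterate_succ_apply]
      rw [pow_succ (δ : ℂ) (N + 1)]
      field_simp

/-- The logarithm of the second component of the conjugacy, divided by the coordinate `w`. -/
theorem exists_log_conj {s : ℂ → ℂ} (hsd : DifferentiableOn ℂ s (ball 0 R))
    (hsb : ∀ z ∈ ball (0 : ℂ) R, ‖s z‖ ≤ 2 * K * ‖z‖) :
    ∃ (S : ℂ × ℂ → ℂ) (L : ℝ), 0 ≤ L ∧ DifferentiableOn ℂ S (wedge l₁ κ R) ∧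
      (∀ r, 0 < r → r ≤ R → ∀ x ∈ wedge l₁ κ r, ‖S x‖ ≤ L * r ^ c) ∧
      ∀ x ∈ wedge l₁ κ R,
        S x + γ * s x.1 = Complex.log (1 + η x) + S (skewProduct p q x) := by
  set f := skewProduct p q with hf
  have hK := h.K_nonneg
  have hs0 : s 0 = 0 := by simpa using hsb 0 (by simpa using h.R_pos)
  -- The equation reads `S = lam + S ∘ f`, without a contracting coefficient. The series `∑ lam ∘
  -- f^N` converges only through the decay of `lam` along orbits.
  set lam : ℂ × ℂ → ℂ := fun x => Complex.log (1 + η x) - γ * s x.1 with hlam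
  have hlam0 : lam 0 = 0 := by simp [hlam, h.η_zero, hs0]
  have hlamd : DifferentiableOn ℂ lam (wedge l₁ κ R) := by
    refine DifferentiableOn.sub (DifferentiableOn.clog (h.η_diff.const_add 1) fun x hx => ?_)
      (DifferentiableOn.const_mul (hsd.comp differentiableOn_fst fun x hx => h.fst_mem_ball hx) _)
    exact Complex.mem_slitPlane_of_norm_lt_one ((h.η_half x hx).trans_lt (by norm_num))
  set L₀ := 3 / 2 * K + γ * (2 * K) with hL₀
  have hL₀0 : 0 ≤ L₀ := by positivity
  have hlamb : ∀ r, 0 < r → r ≤ R → ∀ x ∈ wedge l₁ κ r, ‖lam x‖ ≤ L₀ * r ^ c := by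
    intro r hr hrR x hx
    have hr1 := hrR.trans h.R_le
    have hxR := wedge_mono hrR hx
    have h1 : ‖x.1‖ ≤ r ^ c := by
      refine (norm_fst_lt_of_mem_wedge h.κ_nonneg hr hr1 hx).le.trans ?_
      simpa using Real.rpow_le_rpow_of_exponent_ge hr hr1 h.c_le
    calc ‖lam x‖ ≤ ‖Complex.log (1 + η x)‖ + ‖γ * s x.1‖ := norm_sub_le _ _
      _ ≤ 3 / 2 * (K * r ^ c) + γ * (2 * K * r ^ c) := by
          rw [norm_mul, Complex.norm_natCast]
          refine add_le_add ((Complex.norm_log_one_add_half_le_self (h.η_half x hxR)).trans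
            (mul_le_mul_of_nonneg_left (h.η_le r hr hrR x hx) (by norm_num))) ?_
          refine mul_le_mul_of_nonneg_left ((hsb _ (h.fst_mem_ball hxR)).trans ?_) (by positivity)
          gcongr
      _ = L₀ * r ^ c := by rw [hL₀]; ring
  set θ := ((1 : ℝ) / 2) ^ c with hθ
  have hθ0 : 0 ≤ θ := by positivity
  have hθ1 : θ < 1 := Real.rpow_lt_one (by norm_num) (by norm_num) h.c_pos
  have hgeo : Summable fun N : ℕ => θ ^ N := summable_geometric_of_lt_one hθ0 hθ1
  have hb : ∀ r, 0 < r → r ≤ R → ∀ x ∈ wedge l₁ κ r, ∀ N,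
      ‖lam (f^[N] x)‖ ≤ L₀ * r ^ c * θ ^ N := by
    intro r hr hrR x hx N
    have e : L₀ * r ^ c * θ ^ N = L₀ * (r / 2 ^ N) ^ c := by
      have : ((1 : ℝ) / 2) ^ N = (2 ^ N)⁻¹ := by rw [one_div, inv_pow]
      rw [hθ, ← Real.rpow_natCast, ← Real.rpow_mul (by norm_num), mul_comm c, Real.rpow_mul
        (by norm_num), Real.rpow_natCast, div_eq_mul_inv r, ← this,
        Real.mul_rpow hr.le (by positivity)]
      ring
    -- On `z = 0` the orbit reaches the origin after one step, where `lam` vanishes. Elsewhere the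
    -- `N`-th iterate is in the wedge of radius `r / 2^N`.
    by_cases h0 : x.1 = 0
    · rcases N with _ | N
      · simpa using hlamb r hr hrR x hx
      · rw [h.iterate_eq_zero (wedge_mono hrR hx) h0, hlam0, norm_zero]
        positivity
    · rw [e]
      exact hlamb _ (by positivity) ((div_le_self hr.le (one_le_pow₀ one_le_two)).trans hrR) _
        (h.iterate_mem hr hrR hx h0 N).1
  have hsum : ∀ x ∈ wedge l₁ κ R, Summable fun N => lam (f^[N] x) := fun x hx =>
    Summable.of_norm_bounded (hgeo.mul_left _) fun N => hb R h.R_pos le_rfl x hx N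
  set S : ℂ × ℂ → ℂ := fun x => ∑' N, lam (f^[N] x) with hS
  have hS0 : S 0 = 0 := by
    have : ∀ N, f^[N] 0 = 0 := fun N => Function.iterate_fixed h.map_zero N
    simp [hS, this, hlam0]
  have hfun : ∀ x ∈ wedge l₁ κ R, S x = lam x + S (f x) := by
    intro x hx
    simp only [hS]
    rw [(hsum x hx).tsum_eq_zero_add]
    rfl
  set L := L₀ * (1 - θ)⁻¹ with hL
  have hL0 : 0 ≤ L := mul_nonneg hL₀0 (inv_nonneg.2 (by linarith))
  have hSb : ∀ r, 0 < r → r ≤ R → ∀ x ∈ wedge l₁ κ r, ‖S x‖ ≤ L * r ^ c := by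
    intro r hr hrR x hx
    have hn : Summable fun N => ‖lam (f^[N] x)‖ :=
      Summable.of_nonneg_of_le (fun _ => norm_nonneg _) (hb r hr hrR x hx) (hgeo.mul_left _)
    calc ‖S x‖ ≤ ∑' N, ‖lam (f^[N] x)‖ := norm_tsum_le_tsum_norm hn
      _ ≤ ∑' N, L₀ * r ^ c * θ ^ N := hn.tsum_le_tsum (hb r hr hrR x hx) (hgeo.mul_left _)
      _ = L * r ^ c := by rw [tsum_mul_left, tsum_geometric_of_lt_one hθ0 hθ1, hL]; ring
  have hV : IsOpen (wedge l₁ κ R ∩ {x : ℂ × ℂ | x.1 ≠ 0}) :=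
    h.isOpen_wedge.inter (isOpen_ne.preimage continuous_fst)
  have hmaps : MapsTo f (wedge l₁ κ R ∩ {x | x.1 ≠ 0}) (wedge l₁ κ R ∩ {x | x.1 ≠ 0}) := by
    intro x hx
    have := h.map_mem h.R_pos le_rfl hx.1 hx.2
    exact ⟨wedge_mono (by linarith [h.R_pos]) this.1, this.2⟩
  -- Off `z = 0` the whole orbit remains in the wedge, where `lam` is holomorphic; on `z = 0` it may
  -- leave it.
  have hSd : DifferentiableOn ℂ S (wedge l₁ κ R ∩ {x | x.1 ≠ 0}) := by
    refine differentiableOn_tsum_of_norm_le (hgeo.mul_left (L₀ * R ^ c)) hV (fun N => ?_)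
      fun N x hx => hb R h.R_pos le_rfl x hx.1 N
    exact (hlamd.mono inter_subset_left).comp
      ((h.differentiableOn_skewProduct.mono inter_subset_left).iterate hmaps N) (hmaps.iterate N)
  have hSfd : DifferentiableOn ℂ (fun x => S (f x)) (wedge l₁ κ R ∩ {x | x.1 ≠ 0}) :=
    hSd.comp (h.differentiableOn_skewProduct.mono inter_subset_left) hmaps
  -- The attraction rate `C |z|^e`, rather than the mere factor `1/2`, forces `S ∘ f` to tend to `0`
  -- at the line `z = 0`. This is the continuity needed to remove the singularity there.
  have hSfb : ∀ x ∈ wedge l₁ κ R, ‖S (f x)‖ ≤ L * (R * (C * ‖x.1‖ ^ e)) ^ c := by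
    intro x hx
    have hC := h.C_pos
    have hR := h.R_pos
    by_cases h0 : x.1 = 0
    · rw [hf, h.map_eq_zero hx h0, hS0, norm_zero]
      positivity
    · have hZ := norm_pos_iff.2 h0
      refine hSb _ (by positivity) ?_ _ (h.attract R hR le_rfl x hx h0)
      have h1 : ‖x.1‖ ≤ R := by simpa using (mem_ball.1 (h.fst_mem_ball hx)).le
      have h2 : C * ‖x.1‖ ^ e ≤ 1 / 2 :=
        (mul_le_mul_of_nonneg_left (Real.rpow_le_rpow hZ.le h1 h.e_pos.le) hC.le).trans h.C_half
      have := mul_le_mul_of_nonneg_left h2 hR.le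
      linarith
  have hSfc : ContinuousOn (fun x => S (f x)) (wedge l₁ κ R) := by
    intro x hx
    by_cases h0 : x.1 = 0
    · have hlim : Tendsto (fun y : ℂ × ℂ => L * (R * (C * ‖y.1‖ ^ e)) ^ c)
          (𝓝[wedge l₁ κ R] x) (𝓝 0) := by
        have hc : Continuous fun y : ℂ × ℂ => L * (R * (C * ‖y.1‖ ^ e)) ^ c :=
          continuous_const.mul (Continuous.rpow_const (continuous_const.mul (continuous_const.mul
            (continuous_fst.norm.rpow_const fun _ => Or.inr h.e_pos.le)))
            fun _ => Or.inr h.c_pos.le)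
        have := hc.tendsto x
        simp only [h0, norm_zero, Real.zero_rpow h.e_pos.ne', mul_zero,
          Real.zero_rpow h.c_pos.ne'] at this
        exact this.mono_left nhdsWithin_le_nhds
      have hval : S (f x) = 0 := by rw [hf, h.map_eq_zero hx h0, hS0]
      rw [ContinuousWithinAt, hval]
      refine squeeze_zero_norm' ?_ hlim
      filter_upwards [self_mem_nhdsWithin] with y hy using hSfb y hy
    · exact (hSfd.differentiableAt (hV.mem_nhds ⟨hx, h0⟩)).continuousAt.continuousWithinAt
  refine ⟨S, L, hL0, ?_, hSb, fun x hx => ?_⟩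
  · exact (hlamd.add (differentiableOn_of_continuousOn_of_fst_ne_zero h.isOpen_wedge hSfc
      hSfd)).congr hfun
  · rw [hfun x hx, hlam]; ring

end IsNormalForm

end BottcherSkew

/-! ### Biholomorphy of the conjugacy. -/

namespace BottcherSkew

open Set Filter Topology Metric

theorem exists_continuousLinearEquiv_eq {E : Type*} [NormedAddCommGroup E] [NormedSpace ℂ E]
    [FiniteDimensional ℂ E] (D : E →L[ℂ] E) (hD : Function.Injective D) :
    ∃ D' : E ≃L[ℂ] E, (D' : E →L[ℂ] E) = D :=
  ⟨(LinearEquiv.ofInjectiveEndo (D : E →ₗ[ℂ] E) hD).toContinuousLinearEquiv, by ext v; rfl⟩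

/-- An injective holomorphic map on an open subset of `ℂ²` with everywhere injective derivative is
biholomorphic onto its open image. -/
theorem isBiholomorphicOn_of_injOn {φ : ℂ × ℂ → ℂ × ℂ} {U : Set (ℂ × ℂ)} (hU : IsOpen U)
    (hφ : DifferentiableOn ℂ φ U) (hinj : InjOn φ U)
    (hD : ∀ x ∈ U, Function.Injective (fderiv ℂ φ x)) : IsBiholomorphicOn φ U := by
  have hstrict : ∀ x ∈ U, ∃ D : (ℂ × ℂ) ≃L[ℂ] (ℂ × ℂ),
      HasStrictFDerivAt φ (D : (ℂ × ℂ) →L[ℂ] (ℂ × ℂ)) x := by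
    intro x hx
    obtain ⟨D, hDx⟩ := exists_continuousLinearEquiv_eq _ (hD x hx)
    exact ⟨D, hDx ▸ hasStrictFDerivAt_of_differentiableOn hU hφ hx⟩
  have hinv : ∀ x ∈ U, Function.invFunOn φ U (φ x) = x := fun x hx =>
    hinj.leftInvOn_invFunOn hx
  refine ⟨hU, hφ, isOpen_iff_mem_nhds.2 ?_, Function.invFunOn φ U, ?_, hinv⟩
  · rintro _ ⟨x, hx, rfl⟩
    obtain ⟨D, hDx⟩ := hstrict x hx
    rw [← hDx.map_nhds_eq_of_equiv]
    exact image_mem_map (hU.mem_nhds hx)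
  · rintro _ ⟨x, hx, rfl⟩
    obtain ⟨D, hDx⟩ := hstrict x hx
    exact (hDx.to_local_left_inverse (by
      filter_upwards [hU.mem_nhds hx] with y hy using hinv y hy)).differentiableAt
        |>.differentiableWithinAt

/-- A disc around `w` in a vertical slice of a wedge is contained in a larger wedge. -/
theorem mem_wedge_of_dist_lt {l₁ κ r : ℝ} (hκ : 0 ≤ κ) (hr : 0 < r) {z w v : ℂ}
    (hw : (z, w) ∈ wedge l₁ κ r) (hv : dist v w < ‖w‖ / 2) :
    (z, v) ∈ wedge l₁ κ (2 ^ (κ + 1) * r) := by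
  have hv1 : ‖v‖ ≤ 2 * ‖w‖ := by
    have := norm_le_norm_add_norm_sub' v w
    rw [← dist_eq_norm] at this
    have := norm_nonneg w
    linarith
  have hv2 : ‖w‖ ≤ 2 * ‖v‖ := by
    have := norm_le_norm_add_norm_sub' w v
    rw [← dist_eq_norm, dist_comm] at this
    linarith
  -- The first inequality costs a factor `2^κ` and the second a factor `2`; the product `2^(κ+1)`
  -- covers both.
  have h2κ : (1 : ℝ) ≤ 2 ^ κ := Real.one_le_rpow one_le_two hκ
  rw [Real.rpow_add_one two_ne_zero]
  refine ⟨hw.1.trans_le ?_, hv1.trans_lt ?_⟩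
  · simp only
    calc r * ‖w‖ ^ κ ≤ r * (2 * ‖v‖) ^ κ := by gcongr
      _ = 1 * (2 ^ κ * r * ‖v‖ ^ κ) := by
          rw [Real.mul_rpow zero_le_two (norm_nonneg _)]; ring
      _ ≤ 2 * (2 ^ κ * r * ‖v‖ ^ κ) := by gcongr; norm_num
      _ = _ := by ring
  · simp only
    calc 2 * ‖w‖ < 2 * (r * ‖z‖ ^ l₁) := by
          have : ‖w‖ < r * ‖z‖ ^ l₁ := hw.2
          linarith
      _ = 1 * (2 * (r * ‖z‖ ^ l₁)) := by ring
      _ ≤ 2 ^ κ * (2 * (r * ‖z‖ ^ l₁)) := by gcongr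
      _ = _ := by ring

/-- The function `g - id` is `1/2`-Lipschitz on the convex set, so `g u = g v` forces `|u - v| ≤ |u
- v| / 2`. -/
theorem eq_of_norm_deriv_sub_one_le {g : ℂ → ℂ} {s : Set ℂ} (hs : Convex ℝ s)
    (hd : ∀ z ∈ s, DifferentiableAt ℂ g z) (hb : ∀ z ∈ s, ‖deriv g z - 1‖ ≤ 1 / 2) {u v : ℂ}
    (hu : u ∈ s) (hv : v ∈ s) (huv : g u = g v) : u = v := by
  have := hs.norm_image_sub_le_of_norm_deriv_le (f := fun z => g z - z) (C := 1 / 2)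
    (fun z hz => (hd z hz).sub differentiableAt_fun_id)
    (fun z hz => by
      rw [deriv_fun_sub (hd z hz) differentiableAt_fun_id, deriv_id'']
      exact hb z hz) hv hu
  rw [huv, show g v - u - (g v - v) = -(u - v) by ring, norm_neg] at this
  exact sub_eq_zero.1 (norm_le_zero_iff.1 (by linarith))

theorem norm_exp_sub_one_le_two_mul {u : ℂ} (hu : ‖u‖ ≤ 1) : ‖Complex.exp u - 1‖ ≤ 2 * ‖u‖ :=
  Complex.norm_exp_sub_one_le hu

theorem ne_zero_of_norm_sub_one_le {u : ℂ} (hu : ‖u - 1‖ ≤ 1 / 2) : u ≠ 0 := by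
  rintro rfl
  norm_num at hu

namespace IsNormalForm

variable {p : ℂ → ℂ} {q : ℂ × ℂ → ℂ} {α β : ℂ} {δ γ : ℕ} {l₁ κ : ℝ}
    {ζ : ℂ → ℂ} {η : ℂ × ℂ → ℂ} {R K c C e : ℝ}
    (h : IsNormalForm p q α β δ γ l₁ κ ζ η R K c C e)

include h

/-- The first component of the conjugacy is close to the identity near the origin. -/
theorem exists_norm_deriv_fst_sub_one_le {s : ℂ → ℂ} (hsd : DifferentiableOn ℂ s (ball 0 R))
    (hsb : ∀ z ∈ ball (0 : ℂ) R, ‖s z‖ ≤ 2 * K * ‖z‖) :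
    ∃ ρ, 0 < ρ ∧ ρ ≤ R ∧
      ∀ z ∈ ball (0 : ℂ) ρ, ‖deriv (fun z => z * Complex.exp (s z)) z - 1‖ ≤ 1 / 2 := by
  have h0 : (0 : ℂ) ∈ ball (0 : ℂ) R := mem_ball_self h.R_pos
  have hs0 : s 0 = 0 := by simpa using hsb 0 h0
  have hgd : DifferentiableOn ℂ (fun z => z * Complex.exp (s z)) (ball 0 R) :=
    differentiableOn_id.mul hsd.cexp
  have hs0d := hsd.differentiableAt (isOpen_ball.mem_nhds h0)
  have hd0 : deriv (fun z => z * Complex.exp (s z)) 0 = 1 := by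
    have := (hasDerivAt_id (0 : ℂ)).mul hs0d.hasDerivAt.cexp
    rw [show (fun z => z * Complex.exp (s z)) = id * fun z => Complex.exp (s z) from rfl,
      this.deriv]
    simp [hs0]
  have hc : ContinuousAt (deriv fun z => z * Complex.exp (s z)) 0 :=
    (hgd.deriv isOpen_ball).continuousOn.continuousAt (isOpen_ball.mem_nhds h0)
  have hev : ∀ᶠ z in 𝓝 (0 : ℂ), ‖deriv (fun z => z * Complex.exp (s z)) z - 1‖ < 1 / 2 := by
    refine (hc.sub continuousAt_const).norm.eventually_lt_const ?_
    simp [hd0]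
  obtain ⟨ρ, hρ, hsub⟩ := Metric.mem_nhds_iff.1 hev
  exact ⟨min ρ R, lt_min hρ h.R_pos, min_le_right _ _, fun z hz =>
    (hsub (ball_subset_ball (min_le_left _ _) hz)).le⟩

/-- The second component of the conjugacy is close to the identity along vertical slices. -/
theorem norm_deriv_snd_sub_one_le {S : ℂ × ℂ → ℂ} {r : ℝ}
    (hSd : DifferentiableOn ℂ S (wedge l₁ κ R)) (hr : 0 < r) (hrR : 2 ^ (κ + 1) * r ≤ R)
    (hSb : ∀ x ∈ wedge l₁ κ (2 ^ (κ + 1) * r), ‖S x‖ ≤ 1 / 16) {z w : ℂ}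
    (hw : (z, w) ∈ wedge l₁ κ r) :
    DifferentiableAt ℂ (fun v => v * Complex.exp (S (z, v))) w ∧
      ‖deriv (fun v => v * Complex.exp (S (z, v))) w - 1‖ ≤ 1 / 2 := by
  have hκ1 : (1 : ℝ) ≤ 2 ^ (κ + 1) := Real.one_le_rpow one_le_two (by linarith [h.κ_nonneg])
  have hrΛ : r ≤ 2 ^ (κ + 1) * r := le_mul_of_one_le_left hr.le hκ1
  have hslice : ∀ v, (z, v) ∈ wedge l₁ κ R → DifferentiableAt ℂ (fun v => S (z, v)) v := fun v hv =>
    DifferentiableAt.comp (f := fun v : ℂ => (z, v)) v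
      (hSd.differentiableAt (h.isOpen_wedge.mem_nhds hv)) (by fun_prop)
  have hwd := hslice w (wedge_mono (hrΛ.trans hrR) hw)
  have hder := (hasDerivAt_id w).mul hwd.hasDerivAt.cexp
  refine ⟨hder.differentiableAt, ?_⟩
  have hderiv : deriv (fun v => v * Complex.exp (S (z, v))) w =
      Complex.exp (S (z, w)) * (1 + w * deriv (fun v => S (z, v)) w) := by
    have := hder.deriv
    simp only [id_eq, one_mul] at this
    rw [show (fun v => v * Complex.exp (S (z, v))) = id * fun v => Complex.exp (S (z, v)) from rfl,
      this]
    ring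
  -- Cauchy's estimate on the disc of radius `|w|/2`: the factor `|w|` cancels the radius and leaves
  -- `4 * (1/16)`.
  have hwS : ‖w * deriv (fun v => S (z, v)) w‖ ≤ 1 / 4 := by
    rcases eq_or_ne w 0 with rfl | hw0
    · simp
    have hW : 0 < ‖w‖ := norm_pos_iff.2 hw0
    have hmem : ∀ v ∈ ball w (‖w‖ / 2), (z, v) ∈ wedge l₁ κ (2 ^ (κ + 1) * r) := fun v hv =>
      mem_wedge_of_dist_lt h.κ_nonneg hr hw hv
    have := norm_fderiv_le_of_norm_le_ball (f := fun v => S (z, v)) (c := w) (R := ‖w‖ / 2)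
      (C := 1 / 16) (by positivity)
      (fun v hv => (hslice v (wedge_mono hrR (hmem v hv))).differentiableWithinAt)
      fun v hv => hSb _ (hmem v hv)
    rw [← norm_deriv_eq_norm_fderiv] at this
    rw [norm_mul]
    calc _ ≤ ‖w‖ * (2 * (1 / 16) / (‖w‖ / 2)) := mul_le_mul_of_nonneg_left this hW.le
      _ = 1 / 4 := by field_simp; norm_num
  have hS := hSb _ (wedge_mono hrΛ hw)
  have hexp : ‖Complex.exp (S (z, w)) - 1‖ ≤ 1 / 8 :=
    (norm_exp_sub_one_le_two_mul (hS.trans (by norm_num))).trans (by linarith)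
  rw [hderiv]
  set D := w * deriv (fun v => S (z, v)) w
  have h1D : ‖1 + D‖ ≤ 5 / 4 := by
    have := norm_add_le 1 D
    rw [norm_one] at this
    linarith
  calc ‖Complex.exp (S (z, w)) * (1 + D) - 1‖
      = ‖(Complex.exp (S (z, w)) - 1) * (1 + D) + D‖ := by congr 1; ring
    _ ≤ ‖(Complex.exp (S (z, w)) - 1)‖ * ‖1 + D‖ + ‖D‖ := by
        rw [← norm_mul]; exact norm_add_le _ _
    _ ≤ 1 / 8 * (5 / 4) + 1 / 4 := by gcongr
    _ ≤ 1 / 2 := by norm_num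

/-- The second component of the conjugacy is injective along vertical slices. -/
theorem eq_of_snd_eq {S : ℂ × ℂ → ℂ} {r : ℝ}
    (hSd : DifferentiableOn ℂ S (wedge l₁ κ R)) (hr : 0 < r)
    (hrR : 2 ^ (κ + 1) * (2 ^ (κ + 1) * r) ≤ R)
    (hSb : ∀ x ∈ wedge l₁ κ (2 ^ (κ + 1) * (2 ^ (κ + 1) * r)), ‖S x‖ ≤ 1 / 16) {z w v : ℂ}
    (hw : (z, w) ∈ wedge l₁ κ r) (hv : (z, v) ∈ wedge l₁ κ r)
    (heq : v * Complex.exp (S (z, v)) = w * Complex.exp (S (z, w))) : v = w := by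
  have hκ1 : (1 : ℝ) ≤ 2 ^ (κ + 1) := Real.one_le_rpow one_le_two (by linarith [h.κ_nonneg])
  have hrΛ : r ≤ 2 ^ (κ + 1) * r := le_mul_of_one_le_left hr.le hκ1
  have hrΛ' : r ≤ 2 ^ (κ + 1) * (2 ^ (κ + 1) * r) :=
    hrΛ.trans (le_mul_of_one_le_left (by positivity) hκ1)
  rcases eq_or_ne w 0 with rfl | hw0
  · rw [zero_mul] at heq
    exact (mul_eq_zero.1 heq).resolve_right (Complex.exp_ne_zero _)
  have hW : 0 < ‖w‖ := norm_pos_iff.2 hw0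
  -- For `κ > 0` the slice has a hole at `0` and is not convex, so the derivative bound does not
  -- apply to it directly. Equality of the images first places `v` in the disc of radius `|w|/2`
  -- about `w`. The radius `r` is enlarged once for this disc and once more for the Cauchy discs
  -- about its points.
  have hsub : ‖S (z, w) - S (z, v)‖ ≤ 1 / 8 := by
    have h1 := hSb _ (wedge_mono hrΛ' hw)
    have h2 := hSb _ (wedge_mono hrΛ' hv)
    exact (norm_sub_le _ _).trans (by linarith)
  have hvw : v = w * Complex.exp (S (z, w) - S (z, v)) := by
    rw [Complex.exp_sub, mul_div_assoc', ← heq, mul_div_cancel_right₀ _ (Complex.exp_ne_zero _)]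
  have hdist : v ∈ ball w (‖w‖ / 2) := by
    rw [mem_ball, dist_eq_norm]
    have := (norm_exp_sub_one_le_two_mul (hsub.trans (by norm_num))).trans
      (mul_le_mul_of_nonneg_left hsub zero_le_two)
    calc ‖v - w‖ = ‖w‖ * ‖Complex.exp (S (z, w) - S (z, v)) - 1‖ := by
          rw [← norm_mul, mul_sub, mul_one, ← hvw]
      _ ≤ ‖w‖ * (2 * (1 / 8)) := mul_le_mul_of_nonneg_left this hW.le
      _ < ‖w‖ / 2 := by linarith
  have hball : ∀ u ∈ ball w (‖w‖ / 2), (z, u) ∈ wedge l₁ κ (2 ^ (κ + 1) * r) := fun u hu =>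
    mem_wedge_of_dist_lt h.κ_nonneg hr hw hu
  have hder := fun u hu => h.norm_deriv_snd_sub_one_le hSd (by positivity) hrR hSb (hball u hu)
  exact eq_of_norm_deriv_sub_one_le (convex_ball w (‖w‖ / 2)) (fun u hu => (hder u hu).1)
    (fun u hu => (hder u hu).2) hdist (mem_ball_self (by positivity)) heq

/-- The conjugacy is biholomorphic on small wedges. -/
theorem isBiholomorphicOn_conj {s : ℂ → ℂ} {S : ℂ × ℂ → ℂ} {r : ℝ}
    (hsd : DifferentiableOn ℂ s (ball 0 R)) (hSd : DifferentiableOn ℂ S (wedge l₁ κ R))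
    (hr : 0 < r) (hrR : 2 ^ (κ + 1) * (2 ^ (κ + 1) * r) ≤ R)
    (hs1 : ∀ z ∈ ball (0 : ℂ) r, ‖deriv (fun z => z * Complex.exp (s z)) z - 1‖ ≤ 1 / 2)
    (hSb : ∀ x ∈ wedge l₁ κ (2 ^ (κ + 1) * (2 ^ (κ + 1) * r)), ‖S x‖ ≤ 1 / 16) :
    IsBiholomorphicOn (fun x => (x.1 * Complex.exp (s x.1), x.2 * Complex.exp (S x)))
      (wedge l₁ κ r) := by
  have hκ1 : (1 : ℝ) ≤ 2 ^ (κ + 1) := Real.one_le_rpow one_le_two (by linarith [h.κ_nonneg])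
  have hrΛ : r ≤ 2 ^ (κ + 1) * r := le_mul_of_one_le_left hr.le hκ1
  have hΛ : 2 ^ (κ + 1) * r ≤ 2 ^ (κ + 1) * (2 ^ (κ + 1) * r) :=
    le_mul_of_one_le_left (by positivity) hκ1
  have hrR' : r ≤ R := hrΛ.trans (hΛ.trans hrR)
  have hfst : ∀ x ∈ wedge l₁ κ r, x.1 ∈ ball (0 : ℂ) r := fun x hx => by
    simpa using norm_fst_lt_of_mem_wedge h.κ_nonneg hr (hrR'.trans h.R_le) hx
  have hg : ∀ z ∈ ball (0 : ℂ) r, DifferentiableAt ℂ (fun z => z * Complex.exp (s z)) z :=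
    fun z hz => differentiableAt_fun_id.mul
      (hsd.differentiableAt (isOpen_ball.mem_nhds (ball_subset_ball hrR' hz))).cexp
  have hU : IsOpen (wedge l₁ κ r) := BottcherSkew.isOpen_wedge h.l₁_nonneg h.κ_nonneg
  have hφ : DifferentiableOn ℂ
      (fun x : ℂ × ℂ => (x.1 * Complex.exp (s x.1), x.2 * Complex.exp (S x))) (wedge l₁ κ r) := by
    refine DifferentiableOn.prodMk (differentiableOn_fst.mul (DifferentiableOn.cexp ?_))
      (differentiableOn_snd.mul (hSd.mono (wedge_mono hrR')).cexp)
    exact hsd.comp differentiableOn_fst fun x hx => ball_subset_ball hrR' (hfst x hx)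
  refine isBiholomorphicOn_of_injOn hU hφ ?_ ?_
  · rintro ⟨z, v⟩ hv ⟨z', w⟩ hw heq
    simp only [Prod.mk.injEq] at heq
    obtain rfl : z = z' := eq_of_norm_deriv_sub_one_le (convex_ball (0 : ℂ) r) hg hs1
      (hfst _ hv) (hfst _ hw) heq.1
    rw [h.eq_of_snd_eq hSd hr hrR hSb hw hv heq.2]
  · intro x hx
    have hD := (hφ.differentiableAt (hU.mem_nhds hx)).hasFDerivAt
    set D := fderiv ℂ
      (fun x : ℂ × ℂ => (x.1 * Complex.exp (s x.1), x.2 * Complex.exp (S x))) x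
    have h1 := hs1 _ (hfst x hx)
    have h2 := (h.norm_deriv_snd_sub_one_le hSd hr (hΛ.trans hrR)
      (fun y hy => hSb y (wedge_mono hΛ hy)) hx).2
    -- The differential is triangular; both diagonal entries are within `1/2` of `1`, hence nonzero.
    have e1 : ∀ v, (D v).1 = deriv (fun z => z * Complex.exp (s z)) x.1 * v.1 := by
      intro v
      have a1 := (hg _ (hfst x hx)).hasDerivAt.comp_hasFDerivAt x
        (hasFDerivAt_fst (𝕜 := ℂ) (p := x))
      simpa using DFunLike.congr_fun (hD.fst.unique a1) v
    have e2 : ∀ v : ℂ, (D (0, v)).2 = deriv (fun v => v * Complex.exp (S (x.1, v))) x.2 * v := by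
      intro v
      have a1 : HasDerivAt (fun v : ℂ => (x.1, v)) ((0, 1) : ℂ × ℂ) x.2 :=
        (hasDerivAt_const _ _).prodMk (hasDerivAt_id _)
      have a2 : HasDerivAt (fun v => v * Complex.exp (S (x.1, v))) (D (0, 1)).2 x.2 :=
        HasFDerivAt.comp_hasDerivAt (f := fun v : ℂ => (x.1, v)) x.2 hD.snd a1
      rw [a2.deriv, show ((0, v) : ℂ × ℂ) = v • (0, 1) by simp, map_smul, Prod.smul_snd,
        smul_eq_mul, mul_comm]
    rw [injective_iff_map_eq_zero]
    rintro ⟨u, v⟩ huv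
    obtain rfl : u = 0 := by
      have := e1 (u, v)
      rw [huv] at this
      exact (mul_eq_zero.1 this.symm).resolve_left (ne_zero_of_norm_sub_one_le h1)
    have := e2 v
    rw [huv] at this
    rw [(mul_eq_zero.1 this.symm).resolve_left (ne_zero_of_norm_sub_one_le h2)]
    rfl

end IsNormalForm

end BottcherSkew

/-! ### Assembling the conjugacy. -/

namespace BottcherSkew

open Set Filter Topology Metric

namespace IsNormalForm

variable {p : ℂ → ℂ} {q : ℂ × ℂ → ℂ} {α β : ℂ} {δ γ : ℕ} {l₁ κ : ℝ}
    {ζ : ℂ → ℂ} {η : ℂ × ℂ → ℂ} {R K c C e : ℝ}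
    (h : IsNormalForm p q α β δ γ l₁ κ ζ η R K c C e)

include h

theorem iterate_mem_or_eq_zero {r : ℝ} (hr : 0 < r) (hrR : r ≤ R) (N : ℕ) {x : ℂ × ℂ}
    (hx : x ∈ wedge l₁ κ r) :
    (skewProduct p q)^[N] x ∈ wedge l₁ κ (r / 2 ^ N) ∨
      (x.1 = 0 ∧ (skewProduct p q)^[N] x = 0) := by
  by_cases h0 : x.1 = 0
  · rcases N with _ | N
    · exact Or.inl (by simpa using hx)
    · exact Or.inr ⟨h0, h.iterate_eq_zero (wedge_mono hrR hx) h0 N⟩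
  · exact Or.inl (h.iterate_mem hr hrR hx h0 N).1

theorem exists_isBottcherOn : ∃ r₀ > 0, r₀ ≤ R ∧ ∃ φ : ℂ × ℂ → ℂ × ℂ,
    (∀ r, 0 < r → r ≤ r₀ →
      IsBottcherOn (skewProduct p q) (monomialMap α β δ γ 1) (wedge l₁ κ r) φ) ∧
    ∀ ε > 0, ∃ r₁, 0 < r₁ ∧ r₁ ≤ r₀ ∧ ∀ x ∈ wedge l₁ κ r₁, x ≠ 0 → ‖φ x - x‖ < ε * ‖x‖ := by
  obtain ⟨s, hsd, hsb, hsf⟩ := h.exists_log_bottcher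
  obtain ⟨S, L, hL, hSd, hSb, hSf⟩ := h.exists_log_conj hsd hsb
  obtain ⟨ρ, hρ, hρR, hs1⟩ := h.exists_norm_deriv_fst_sub_one_le hsd hsb
  have hκ := h.κ_nonneg
  have hK := h.K_nonneg
  have hκ1 : (1 : ℝ) ≤ 2 ^ (κ + 1) := Real.one_le_rpow one_le_two (by linarith)
  have hlim : ∀ ε > 0, ∀ᶠ r in 𝓝[>] (0 : ℝ), L * r ^ c < ε := by
    intro ε hε
    have hc : Continuous fun r : ℝ => L * r ^ c :=
      continuous_const.mul (continuous_id.rpow_const fun _ => Or.inr h.c_pos.le)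
    have := hc.tendsto 0
    rw [Real.zero_rpow h.c_pos.ne', mul_zero] at this
    exact (this.mono_left nhdsWithin_le_nhds).eventually_lt_const hε
  have hlim1 : ∀ (M : ℝ), ∀ ε > 0, ∀ᶠ r in 𝓝[>] (0 : ℝ), M * r < ε := by
    intro M ε hε
    have hc : Continuous fun r : ℝ => M * r := by fun_prop
    have := hc.tendsto 0
    rw [mul_zero] at this
    exact (this.mono_left nhdsWithin_le_nhds).eventually_lt_const hε
  obtain ⟨R', ⟨hR'1, hR'2⟩, hR'0⟩ :=
    (((hlim (1 / 16) (by norm_num)).and (hlim1 1 ρ hρ)).and self_mem_nhdsWithin).exists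
  rw [one_mul] at hR'2
  have hR'0 : 0 < R' := hR'0
  -- Two enlargements by `2^(κ+1)` take the wedge of radius `r₀` into that of radius `R'`, where
  -- `|S| < 1/16`.
  set r₀ := R' / (2 ^ (κ + 1) * 2 ^ (κ + 1)) with hr₀
  have hr₀0 : 0 < r₀ := by positivity
  have hr₀R' : 2 ^ (κ + 1) * (2 ^ (κ + 1) * r₀) = R' := by rw [hr₀]; field_simp
  have hr₀le : r₀ ≤ R' := by
    rw [← hr₀R']
    exact (le_mul_of_one_le_left hr₀0.le hκ1).trans (le_mul_of_one_le_left (by positivity) hκ1)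
  have hR'R : R' ≤ R := hR'2.le.trans hρR
  refine ⟨r₀, hr₀0, hr₀le.trans hR'R,
    fun x => (x.1 * Complex.exp (s x.1), x.2 * Complex.exp (S x)), fun r hr hrr₀ => ?_,
    fun ε hε => ?_⟩
  · have hrR' : r ≤ R' := hrr₀.trans hr₀le
    have hle : 2 ^ (κ + 1) * (2 ^ (κ + 1) * r) ≤ R' := by rw [← hr₀R']; gcongr
    refine ⟨fun x hx => ?_, ?_, by simp, fun x hx => ?_⟩
    · rcases h.iterate_mem_or_eq_zero hr (hrR'.trans hR'R) 1 hx with h1 | h1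
      · exact Or.inl (wedge_mono (by linarith) h1)
      · exact Or.inr h1
    · refine h.isBiholomorphicOn_conj hsd hSd hr (hle.trans hR'R)
        (fun z hz => hs1 z (ball_subset_ball (hrR'.trans hR'2.le) hz)) fun x hx => ?_
      exact (hSb R' hR'0 hR'R x (wedge_mono hle hx)).trans hR'1.le
    · have hxR := wedge_mono (hrR'.trans hR'R) hx
      have hδ0 : δ ≠ 0 := by have := h.two_le; omega
      have hγ0 : γ ≠ 0 := by have := h.one_le; omega
      -- On `z = 0` both sides of the conjugacy are the origin, because `δ` and `γ` are positive.
      by_cases h0 : x.1 = 0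
      · simp only [h.map_eq_zero hxR h0, monomialMap, h0]
        simp [hδ0, hγ0]
      · have hz := h.fst_mem_ball hxR
        have hζ0 : 1 + ζ x.1 ≠ 0 := fun h1 => by
          have := half_le_norm_one_add (h.ζ_half _ hz)
          rw [h1, norm_zero] at this
          norm_num at this
        have hη0 : 1 + η x ≠ 0 := fun h1 => by
          have := half_le_norm_one_add (h.η_half _ hxR)
          rw [h1, norm_zero] at this
          norm_num at this
        have e1 : Complex.exp (s x.1) ^ δ = (1 + ζ x.1) * Complex.exp (s (p x.1)) := by
          rw [← Complex.exp_nat_mul, hsf _ hz, Complex.exp_add, Complex.exp_log hζ0]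
        have e2 : Complex.exp (S x) * Complex.exp (s x.1) ^ γ =
            (1 + η x) * Complex.exp (S (skewProduct p q x)) := by
          rw [← Complex.exp_nat_mul, ← Complex.exp_add, hSf _ hxR, Complex.exp_add,
            Complex.exp_log hη0]
        ext
        · simp only [monomialMap, skewProduct]
          rw [mul_pow, e1, h.p_eq _ hz]
          ring
        · simp only [monomialMap]
          rw [show (skewProduct p q x).2 = q x from rfl, h.q_eq _ hxR, mul_pow, pow_one]
          linear_combination (-(β * x.1 ^ γ * x.2)) * e2
  · obtain ⟨r₁, ⟨⟨⟨h1, h2⟩, h3⟩, h4⟩, hr₁⟩ :=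
      (((((hlim 1 one_pos).and (hlim (ε / 2) (by positivity))).and
        (hlim1 (2 * K) (min 1 (ε / 2)) (by positivity))).and (hlim1 1 r₀ hr₀0)).and
          self_mem_nhdsWithin).exists
    rw [one_mul] at h4
    have hr₁ : 0 < r₁ := hr₁
    have hr₁R : r₁ ≤ R := h4.le.trans (hr₀le.trans hR'R)
    refine ⟨r₁, hr₁, h4.le, fun x hx hx0 => ?_⟩
    have hz := norm_fst_lt_of_mem_wedge hκ hr₁ (hr₁R.trans h.R_le) hx
    have hs : ‖s x.1‖ < min 1 (ε / 2) :=
      ((hsb _ (h.fst_mem_ball (wedge_mono hr₁R hx))).trans (by gcongr)).trans_lt h3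
    have hS := hSb r₁ hr₁ hr₁R x hx
    have k1 : ‖Complex.exp (s x.1) - 1‖ < ε := by
      have := norm_exp_sub_one_le_two_mul (hs.le.trans (min_le_left _ _))
      have := hs.trans_le (min_le_right _ _)
      linarith
    have k2 : ‖Complex.exp (S x) - 1‖ < ε := by
      have := norm_exp_sub_one_le_two_mul (hS.trans h1.le)
      linarith
    -- The components of `φ x - x` are `z (e^s - 1)` and `w (e^S - 1)`. Passing to `ε' < ε` gives
    -- the strict inequality even if one coordinate vanishes.
    set ε' := max ‖Complex.exp (s x.1) - 1‖ ‖Complex.exp (S x) - 1‖ with hε'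
    have hε'ε : ε' < ε := max_lt k1 k2
    have hxn : 0 < ‖x‖ := norm_pos_iff.2 hx0
    refine lt_of_le_of_lt ?_ (mul_lt_mul_of_pos_right hε'ε hxn)
    have e3 : ∀ u v : ℂ, ‖u * v - u‖ = ‖v - 1‖ * ‖u‖ := fun u v => by
      rw [← norm_mul]; congr 1; ring
    rw [Prod.norm_def]
    refine max_le ?_ ?_
    · simp only [Prod.fst_sub]
      rw [e3]
      exact mul_le_mul (le_max_left _ _) (norm_fst_le x) (norm_nonneg _)
        ((norm_nonneg _).trans (le_max_left _ _))
    · simp only [Prod.snd_sub]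
      rw [e3]
      exact mul_le_mul (le_max_right _ _) (norm_snd_le x) (norm_nonneg _)
        ((norm_nonneg _).trans (le_max_left _ _))

end IsNormalForm

end BottcherSkew

theorem mainTheorem3 :
    (∀ (p : ℂ → ℂ) (q : ℂ × ℂ → ℂ) (a : ℕ → ℂ) (b : ℕ → ℕ → ℂ) (δ s : ℕ) (n m : ℕ → ℕ)
      (γ d : ℕ) (l₁ κ : ℝ),
      BottcherSkew.IsSuperattractingSkewProduct p q a b δ →
      BottcherSkew.IsVertexList b s n m →
      BottcherSkew.IsDominantData δ s n m γ d l₁ κ →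
      d = 1 →
      (∀ k, 1 ≤ k → k + 1 ≤ s → (δ : ℝ) ≠ BottcherSkew.intercept n m k) →
      ∃ r₀ > 0,
        (∀ r, 0 < r → r ≤ r₀ → ∀ N : ℕ, ∀ x ∈ BottcherSkew.wedge l₁ κ r,
          (BottcherSkew.skewProduct p q)^[N] x ∈ BottcherSkew.wedge l₁ κ (r / 2 ^ N) ∨
            (x.1 = 0 ∧ (BottcherSkew.skewProduct p q)^[N] x = 0)) ∧
        ∃ φ : ℂ × ℂ → ℂ × ℂ,
          (∀ r, 0 < r → r ≤ r₀ →
            BottcherSkew.IsBottcherOn (BottcherSkew.skewProduct p q)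
              (BottcherSkew.monomialMap (a δ) (b γ d) δ γ d) (BottcherSkew.wedge l₁ κ r) φ) ∧
          ∀ ε > 0, ∃ r₁, 0 < r₁ ∧ r₁ ≤ r₀ ∧
            ∀ x ∈ BottcherSkew.wedge l₁ κ r₁, x ≠ 0 → ‖φ x - x‖ < ε * ‖x‖) ∧
    (∀ γ : ℕ, 1 ≤ γ →
      ∃ (a : ℕ → ℂ) (b : ℕ → ℕ → ℂ) (s : ℕ) (n m : ℕ → ℕ) (l₁ κ : ℝ),
        BottcherSkew.IsSuperattractingSkewProduct (fun z => z ^ 2)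
          (fun x => x.1 ^ γ * x.2 + x.1 ^ (2 * γ)) a b 2 ∧
        BottcherSkew.IsVertexList b s n m ∧
        BottcherSkew.IsDominantData 2 s n m γ 1 l₁ κ ∧
        1 < s ∧ BottcherSkew.intercept n m 1 = 2 ∧
        ∀ r > 0, ¬ ∃ φ : ℂ × ℂ → ℂ × ℂ,
          BottcherSkew.IsBottcherOn
            (BottcherSkew.skewProduct (fun z => z ^ 2)
              (fun x => x.1 ^ γ * x.2 + x.1 ^ (2 * γ)))
            (BottcherSkew.monomialMap (a 2) (b γ 1) 2 γ 1) (BottcherSkew.wedge l₁ κ r) φ) := by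
  refine ⟨?_, BottcherSkew.exists_resonant_not_isBottcherOn⟩
  intro p q a b δ s n m γ d l₁ κ hf hv hdata hd hT
  have hadm := hdata.isAdmissible hf.two_le hf.eigenvalue hv hd hT
  obtain ⟨ζ, η, R, K, c, C, e, h⟩ := hadm.exists_isNormalForm hf
  obtain ⟨r₀, hr₀, hr₀R, φ, hφ, hid⟩ := h.exists_isBottcherOn
  subst hd
  exact ⟨r₀, hr₀, fun r hr hrr₀ N x hx => h.iterate_mem_or_eq_zero hr (hrr₀.trans hr₀R) N hx,
    φ, hφ, hid⟩
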